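/- Let $\alpha>0$, $\lambda>0$, and let $\gamma_{\alpha,\lambda}$ be a gamma random variable, with density $\frac{\lambda^\alpha}{\Gamma(\alpha)}x^{\alpha-1}e^{-\lambda x}$ on $(0,\infty)$. Call $\psi$ a background driving characteristic function (BDCF) of a characteristic function $\phi$ if there are a real Lévy process $(Y(t))_{t\ge 0}$ with $\mathbb{E}\log(1+|Y(1)|)<\infty$ and a random variable $X=\int_0^\infty e^{-s}\,dY(s)$ (the limit in probability of $\int_{(0,T]}e^{-s}\,dY(s)$ as $T\to\infty$, where the integral over $(0,T]$ is defined pathwise by integration by parts) such that $\phi$ is the characteristic function of $X$ and $\psi$ is the characteristic function of $Y(1)$. For $x>0$ put $$h_\alpha(x):=\frac{\alpha+(1-\alpha)e^{-x}}{(1-e^{-x})^{2}} .$$ Then the characteristic function of $\log\gamma_{\alpha,\lambda}$ has a BDCF, it is unique, and it is given for all $t\in\mathbb{R}$ by $$\psi_{\log\gamma_{\alpha,\lambda}}(t)=\exp\Big[it\big(-\log\lambda+\Psi(\alpha)\big)+\int_0^\infty\big(e^{-itx}-1+itx\big)e^{-\alpha x}h_\alpha(x)\,dx\Big],$$ where $\Psi=\Gamma'/\Gamma$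 is the digamma function and the integral converges absolutely for every $t\in\mathbb{R}$. Moreover, $$\int_0^\infty x^2e^{-\alpha x}h_\alpha(x)\,dx<\infty .$$ -/

import Mathlib

open MeasureTheory ProbabilityTheory Filter Topology
open scoped NNReal

universe u

/-- A real-valued Lévy process on the probability space `(Ω, P)`, indexed by `t ≥ 0`: it starts at
`0`, has independent and stationary increments, and its paths are almost surely càdlàg. -/
structure IsLevyProcess {Ω : Type u} [MeasurableSpace Ω] (Y : ℝ≥0 → Ω → ℝ) (P : Measure Ω) :
    Prop where
  measurable : ∀ t, Measurable (Y t)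
  start_zero : ∀ᵐ ω ∂P, Y 0 ω = 0
  indep_increments : HasIndepIncrements Y P
  stationary_increments : ∀ s t : ℝ≥0, P.map (fun ω ↦ Y (s + t) ω - Y s ω) = P.map (Y t)
  cadlag : ∀ᵐ ω ∂P, ∀ t : ℝ≥0, ContinuousWithinAt (fun r ↦ Y r ω) (Set.Ici t) t ∧
    ∃ l : ℝ, Tendsto (fun r ↦ Y r ω) (𝓝[<] t) (𝓝 l)

/-- The random integral `∫_{(0,T]} e^{-s} dY(s)`, defined pathwise through integration by parts:
`e^{-T} Y(T) - Y(0) - ∫_0^T Y(s) d(e^{-s})`. -/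
noncomputable def expIntegral {Ω : Type u} (Y : ℝ≥0 → Ω → ℝ) (T : ℝ≥0) (ω : Ω) : ℝ :=
  Real.exp (-(T : ℝ)) * Y T ω - Y 0 ω
    + ∫ s in (0 : ℝ)..(T : ℝ), Real.exp (-s) * Y s.toNNReal ω

/-- `ψ` is a background driving characteristic function of `φ`: there are a Lévy process `Y` with
`𝔼 log (1 + |Y(1)|) < ∞` and a random variable `X = ∫_0^∞ e^{-s} dY(s)`, the improper integral
being the limit in probability of `∫_{(0,T]} e^{-s} dY(s)` as `T → ∞`, such that `φ` is the
characteristic function of `X` and `ψ` is that of `Y(1)`. -/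
def IsBDCF (φ ψ : ℝ → ℂ) : Prop :=
  ∃ (Ω : Type u) (_ : MeasurableSpace Ω) (P : Measure Ω) (Y : ℝ≥0 → Ω → ℝ) (X : Ω → ℝ),
    IsProbabilityMeasure P ∧
    IsLevyProcess Y P ∧
    Integrable (fun ω ↦ Real.log (1 + |Y 1 ω|)) P ∧
    Measurable X ∧
    TendstoInMeasure P (expIntegral Y) atTop X ∧
    charFun (P.map X) = φ ∧
    charFun (P.map (Y 1)) = ψ

/-- The law of `log γ_{α,λ}`, where `γ_{α,λ}` has density
`λ^α / Γ(α) * x^(α-1) * e^{-λx}` on `(0, ∞)`. -/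
noncomputable def logGammaLaw (α lam : ℝ) : Measure ℝ :=
  (gammaMeasure α lam).map Real.log

/-- The function `h_α(x) = [α + (1 - α) e^{-x}] (1 - e^{-x})^{-2}`. -/
noncomputable def hFun (α x : ℝ) : ℝ :=
  (α + (1 - α) * Real.exp (-x)) * (1 - Real.exp (-x)) ^ (-2 : ℤ)

/-- The integrand `(e^{-itx} - 1 + itx) e^{-αx} h_α(x)`. -/
noncomputable def bdcfIntegrand (α t x : ℝ) : ℂ :=
  (Complex.exp (-(Complex.I * t * x)) - 1 + Complex.I * t * x)
    * ((Real.exp (-(α * x)) * hFun α x : ℝ) : ℂ)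

/-- The function
`exp [it (-log λ + Ψ(α)) + ∫_0^∞ (e^{-itx} - 1 + itx) e^{-αx} h_α(x) dx]` of `t`,
with `Ψ` the digamma function. -/
noncomputable def logGammaBDCF (α lam t : ℝ) : ℂ :=
  Complex.exp (Complex.I * t * (-(Real.log lam : ℂ) + Complex.digamma (α : ℂ))
    + ∫ x in Set.Ioi (0 : ℝ), bdcfIntegrand α t x)

/-! Let `φ` be the characteristic function of `log γ`, so `φ(t) = λ^(-it) Γ(α + it) / Γ(α)`. If `Y`
is a Lévy process with exponent `η`, then `∫_{(0,T]} e^{-s} dY(s)` has characteristic function `exp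
∫_0^T η(θ e^{-s}) ds` (`IsLevyProcess.charFun_expIntegral`). When its limit as `T → ∞` is `φ`,
splitting the integral at `h` and differentiating at `h = 0` gives `η(θ) φ(θ) = θ φ'(θ)`
(`exponent_mul_eq_of_tendsto`). Since `φ` has no zeros, `η` is forced, which is uniqueness.

The logarithmic derivative of the Weierstrass product of `Γ` gives `θ φ'(θ) / φ(θ)` as `iθ(-log λ +
Ψ(α))` plus the series of `iθ (1/(α+k) - 1/(α+k+iθ))` (`hasDerivAt_charFun_logGammaLaw`). The `k`-th
term is the integral of `e^{-iθx} - 1 + iθx` against the exponential density of rate `α + k`, and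
these densities add up to `e^{-αx} h_α(x)` (`hasSum_exp_mul_hFun`, `integral_bdcfIntegrand`).

The same decomposition builds the process. For each `k` take an independent compensated compound
Poisson process of rate `1` whose jumps are negatives of exponentials of rate `α + k`. The variances
are of order `(α + k)^{-2}`, hence summable; Doob's inequality and Borel–Cantelli give almost sure
locally uniform convergence to a càdlàg limit (`ae_isCadlag_limitJumps`). After a drift is added,
`𝔼|Y(t)|` grows at most linearly, so the exponential integral converges in `L¹`, and the equation `θ
φ' = η φ` read backwards identifies its law (`tendsto_exp_integral_exponent`). -/

/-! ### The Lévy–Khintchine integral as a series -/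

/-- The characteristic exponent of a compensated compound Poisson process with rate `1` whose
jumps are the negatives of exponential variables of rate `β`. -/
noncomputable def levyTerm (β θ : ℝ) : ℂ :=
  Complex.I * θ / β - Complex.I * θ / (β + Complex.I * θ)

lemma ofReal_add_I_mul_ne_zero {β : ℝ} (hβ : 0 < β) (θ : ℝ) : (β : ℂ) + Complex.I * θ ≠ 0 := by
  intro h
  have := congrArg Complex.re h
  simp at this
  exact hβ.ne' this

lemma le_norm_ofReal_add_I_mul {β : ℝ} (θ : ℝ) : β ≤ ‖(β : ℂ) + Complex.I * θ‖ := by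
  have := Complex.re_le_norm ((β : ℂ) + Complex.I * θ)
  simpa using this

lemma inv_sub_inv_add_I_mul {β : ℝ} (hβ : 0 < β) (θ : ℝ) :
    (1 : ℂ) / β - 1 / (β + Complex.I * θ) = Complex.I * θ / (β * (β + Complex.I * θ)) := by
  have h1 := ofReal_add_I_mul_ne_zero hβ θ
  have h2 : (β : ℂ) ≠ 0 := by exact_mod_cast hβ.ne'
  field_simp
  ring

lemma norm_inv_sub_inv_le {β : ℝ} (hβ : 0 < β) (θ : ℝ) :
    ‖(1 : ℂ) / β - 1 / (β + Complex.I * θ)‖ ≤ |θ| * (1 / β ^ 2) := by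
  rw [inv_sub_inv_add_I_mul hβ, norm_div, norm_mul, norm_mul, Complex.norm_I, one_mul,
    Complex.norm_real, Complex.norm_real, Real.norm_eq_abs, Real.norm_eq_abs, abs_of_pos hβ,
    mul_one_div]
  have := le_norm_ofReal_add_I_mul (β := β) θ
  rw [sq]
  gcongr

lemma levyTerm_eq (β θ : ℝ) :
    levyTerm β θ = Complex.I * θ * (1 / β - 1 / (β + Complex.I * θ)) := by
  rw [levyTerm]; ring

/-- This bound serves twice: its decay in `β` makes the series over `β = α + k` converge, and its
order in `θ` later yields variance bounds. -/
lemma norm_levyTerm_le {β : ℝ} (hβ : 0 < β) (θ : ℝ) :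
    ‖levyTerm β θ‖ ≤ θ ^ 2 * (1 / β ^ 2) := by
  rw [levyTerm_eq, norm_mul, norm_mul, Complex.norm_I, one_mul, Complex.norm_real,
    Real.norm_eq_abs]
  calc |θ| * _ ≤ |θ| * (|θ| * (1 / β ^ 2)) := by gcongr; exact norm_inv_sub_inv_le hβ θ
    _ = θ ^ 2 * (1 / β ^ 2) := by rw [← mul_assoc, abs_mul_abs_self, ← sq]

/-- Against an exponential density the three summands are separately integrable, unlike against the
full Lévy density, which behaves like `x^{-2}` at `0`. -/
lemma integral_compensated_exp {β : ℝ} (hβ : 0 < β) (t : ℝ) :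
    IntegrableOn (fun x : ℝ ↦ (Complex.exp (-(Complex.I * t * x)) - 1 + Complex.I * t * x)
      * ((β * Real.exp (-(β * x)) : ℝ) : ℂ)) (Set.Ioi 0) ∧
    ∫ x in Set.Ioi (0 : ℝ), (Complex.exp (-(Complex.I * t * x)) - 1 + Complex.I * t * x)
      * ((β * Real.exp (-(β * x)) : ℝ) : ℂ) = levyTerm β t := by
  have h1 := ofReal_add_I_mul_ne_zero hβ t
  have h2 : (β : ℂ) ≠ 0 := by exact_mod_cast hβ.ne'
  have re1 : (-((β : ℂ) + Complex.I * t)).re < 0 := by simp [hβ]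
  have re2 : (-(β : ℂ)).re < 0 := by simp [hβ]
  have i1 := integrableOn_exp_mul_complex_Ioi re1 0
  have i2 := integrableOn_exp_mul_complex_Ioi re2 0
  have v1 := integral_exp_mul_complex_Ioi re1 0
  have v2 := integral_exp_mul_complex_Ioi re2 0
  have i3 : IntegrableOn (fun x : ℝ ↦ (x : ℂ) * Complex.exp (-(β * x))) (Set.Ioi 0) := by
    have := (integrableOn_rpow_mul_exp_neg_mul_rpow (p := 1) (s := 1) (b := β) (by norm_num)
      one_pos hβ).ofReal (𝕜 := ℂ)
    refine this.congr (ae_of_all _ fun x ↦ ?_)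
    simp
  have v3 : ∫ x in Set.Ioi (0 : ℝ), (x : ℂ) * Complex.exp (-(β * x)) = 1 / (β : ℂ) ^ 2 := by
    have := Complex.integral_cpow_mul_exp_neg_mul_Ioi (a := 2) (r := β) (by norm_num) hβ
    norm_num at this
    simpa using this
  have e : (fun x : ℝ ↦ (Complex.exp (-(Complex.I * t * x)) - 1 + Complex.I * t * x)
      * ((β * Real.exp (-(β * x)) : ℝ) : ℂ)) = fun x : ℝ ↦
      β * Complex.exp (-((β : ℂ) + Complex.I * t) * x) - β * Complex.exp (-(β : ℂ) * x)
        + Complex.I * t * β * ((x : ℂ) * Complex.exp (-(β * x))) := by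
    ext x
    have : Complex.exp (-((β : ℂ) + Complex.I * t) * x)
        = Complex.exp (-(Complex.I * t * x)) * Complex.exp (-(β * x)) := by
      rw [← Complex.exp_add]; congr 1; ring
    rw [this]
    push_cast
    rw [neg_mul]
    ring
  rw [e]
  refine ⟨((i1.const_mul _).sub (i2.const_mul _)).add (i3.const_mul _), ?_⟩
  rw [integral_add (by exact (i1.const_mul _).sub (i2.const_mul _)) (i3.const_mul _),
    integral_sub (i1.const_mul _) (i2.const_mul _), integral_const_mul, integral_const_mul,
    integral_const_mul, v1, v2, v3, levyTerm]
  simp only [Complex.ofReal_zero, mul_zero, Complex.exp_zero]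
  field_simp
  ring

/-- A Taylor estimate for `|y| ≤ 1`; otherwise the triangle inequality gives `1 + 1 + |y|`, whence
the constant `3`. -/
lemma norm_exp_sub_one_add_le (y : ℝ) :
    ‖Complex.exp (-(Complex.I * y)) - 1 + Complex.I * y‖ ≤ 3 * y ^ 2 := by
  have hn : ‖-(Complex.I * (y : ℂ))‖ = |y| := by simp
  rcases le_total |y| 1 with h | h
  · have := Complex.norm_exp_sub_one_sub_id_le (x := -(Complex.I * y)) (by rw [hn]; exact h)
    rw [hn, sq_abs, sub_neg_eq_add] at this
    nlinarith [sq_nonneg y]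
  · have h3 : ‖Complex.exp (-(Complex.I * y))‖ = 1 := by
      rw [show -(Complex.I * (y : ℂ)) = ((-y : ℝ) : ℂ) * Complex.I by push_cast; ring]
      exact Complex.norm_exp_ofReal_mul_I _
    calc ‖Complex.exp (-(Complex.I * y)) - 1 + Complex.I * y‖
        ≤ ‖Complex.exp (-(Complex.I * y))‖ + ‖(1 : ℂ)‖ + ‖Complex.I * (y : ℂ)‖ :=
          (norm_add_le _ _).trans (by gcongr; exact norm_sub_le _ _)
      _ = 1 + 1 + |y| := by rw [h3]; simp
      _ ≤ 3 * y ^ 2 := by nlinarith [sq_abs y]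

lemma hFun_eq (α x : ℝ) :
    hFun α x = (α + (1 - α) * Real.exp (-x)) / (1 - Real.exp (-x)) ^ 2 := by
  rw [hFun, zpow_neg, div_eq_mul_inv]; norm_cast

/-- The series `∑ r^k` and `∑ k r^k` at `r = e^{-x}`. This splits the Lévy density into exponential
densities, one for each pole of `Γ(α + z)`. -/
lemma hasSum_exp_mul_hFun (α : ℝ) {x : ℝ} (hx : 0 < x) :
    HasSum (fun k : ℕ ↦ (α + k) * Real.exp (-((α + k) * x))) (Real.exp (-(α * x)) * hFun α x) := by
  have hr1 : Real.exp (-x) < 1 := by rw [Real.exp_lt_one_iff]; linarith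
  have hr0 := Real.exp_pos (-x)
  have a1 := (hasSum_geometric_of_lt_one hr0.le hr1).mul_left α
  have a2 := hasSum_coe_mul_geometric_of_norm_lt_one
    (r := Real.exp (-x)) (by rwa [Real.norm_eq_abs, abs_of_pos hr0])
  have h0 : 1 - Real.exp (-x) ≠ 0 := by linarith
  have e (k : ℕ) : (α + k) * Real.exp (-((α + k) * x)) =
      Real.exp (-(α * x)) * (α * Real.exp (-x) ^ k + k * Real.exp (-x) ^ k) := by
    rw [← Real.exp_nat_mul, ← add_mul, mul_left_comm, ← Real.exp_add]
    congr 2; ring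
  have e' : Real.exp (-(α * x)) * hFun α x = Real.exp (-(α * x)) *
      (α * (1 - Real.exp (-x))⁻¹ + Real.exp (-x) / (1 - Real.exp (-x)) ^ 2) := by
    rw [hFun_eq]
    field_simp
    ring
  simp_rw [e, e']
  exact (a1.add a2).mul_left (Real.exp (-(α * x)))

/-- The double pole of `h_α` at `0` is absorbed by `x²`: since `1 - e^{-x} ≥ x / (1 + x)`, the
quotient `x² / (1 - e^{-x})²` is at most `(1 + x)²`, and `e^{-αx}` handles infinity. -/
lemma integrableOn_sq_mul_hFun {α : ℝ} (hα : 0 < α) :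
    IntegrableOn (fun x : ℝ ↦ x ^ 2 * (Real.exp (-(α * x)) * hFun α x)) (Set.Ioi 0) := by
  have hi (n : ℕ) : IntegrableOn (fun x : ℝ ↦ x ^ n * Real.exp (-(α * x))) (Set.Ioi 0) := by
    have := integrableOn_rpow_mul_exp_neg_mul_rpow (p := 1) (s := n) (b := α)
      (by have : (0 : ℝ) ≤ n := n.cast_nonneg
          linarith) one_pos hα
    refine this.congr (ae_of_all _ fun x ↦ ?_)
    simp
  have hdom : IntegrableOn (fun x : ℝ ↦ (1 + α) * (x ^ 0 * Real.exp (-(α * x))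
      + 2 * (x ^ 1 * Real.exp (-(α * x))) + x ^ 2 * Real.exp (-(α * x)))) (Set.Ioi 0) :=
    (((hi 0).add ((hi 1).const_mul 2)).add (hi 2)).const_mul _
  refine hdom.mono' ?_ ?_
  · refine Measurable.aestronglyMeasurable ?_
    unfold hFun
    fun_prop
  · rw [ae_restrict_iff' measurableSet_Ioi]
    refine ae_of_all _ fun x (hx : 0 < x) ↦ ?_
    have hr1 : Real.exp (-x) < 1 := by rw [Real.exp_lt_one_iff]; linarith
    have hr0 := Real.exp_pos (-x)
    have key : x / (1 + x) ≤ 1 - Real.exp (-x) := by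
      have h1 := Real.add_one_le_exp x
      have : Real.exp (-x) ≤ 1 / (1 + x) := by
        rw [Real.exp_neg, ← one_div]; gcongr; linarith
      have h3 : x / (1 + x) = 1 - 1 / (1 + x) := by field_simp; ring
      linarith
    have key2 : x ^ 2 / (1 - Real.exp (-x)) ^ 2 ≤ (1 + x) ^ 2 := by
      rw [div_le_iff₀ (by have : 0 < 1 - Real.exp (-x) := by linarith
                          positivity), ← mul_pow]
      have : x ≤ (1 + x) * (1 - Real.exp (-x)) := by
        rw [div_le_iff₀ (by linarith)] at key; linarith
      gcongr
    have hnum : 0 ≤ α + (1 - α) * Real.exp (-x) := by nlinarith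
    have hnum' : α + (1 - α) * Real.exp (-x) ≤ 1 + α := by nlinarith
    have e : x ^ 2 * (Real.exp (-(α * x)) * hFun α x) = Real.exp (-(α * x)) *
        ((α + (1 - α) * Real.exp (-x)) * (x ^ 2 / (1 - Real.exp (-x)) ^ 2)) := by
      rw [hFun_eq]; ring
    rw [e, Real.norm_of_nonneg (by positivity)]
    calc _ ≤ Real.exp (-(α * x)) * ((1 + α) * (1 + x) ^ 2) := by gcongr
      _ = _ := by ring

lemma measurable_bdcfIntegrand (α t : ℝ) : Measurable (bdcfIntegrand α t) := by
  unfold bdcfIntegrand hFun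
  fun_prop

lemma integrableOn_bdcfIntegrand {α : ℝ} (hα : 0 < α) (t : ℝ) :
    IntegrableOn (bdcfIntegrand α t) (Set.Ioi 0) := by
  refine ((integrableOn_sq_mul_hFun hα).norm.const_mul (3 * t ^ 2)).mono'
    (measurable_bdcfIntegrand α t).aestronglyMeasurable (ae_of_all _ fun x ↦ ?_)
  rw [bdcfIntegrand, norm_mul, norm_mul (x ^ 2), Complex.norm_real]
  have := norm_exp_sub_one_add_le (t * x)
  push_cast at this
  rw [← mul_assoc] at this
  calc _ ≤ 3 * (t * x) ^ 2 * ‖Real.exp (-(α * x)) * hFun α x‖ := by gcongr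
    _ = _ := by rw [Real.norm_of_nonneg (sq_nonneg x)]; ring

lemma summable_inv_sq_add {α : ℝ} (hα : 0 < α) : Summable (fun k : ℕ ↦ 1 / (α + k) ^ 2) := by
  have := (Real.summable_one_div_nat_add_rpow α 2).2 one_lt_two
  refine this.congr fun k ↦ ?_
  rw [abs_of_pos (by positivity), add_comm]
  norm_cast

lemma summable_levyTerm {α : ℝ} (hα : 0 < α) (t : ℝ) :
    Summable (fun k : ℕ ↦ levyTerm (α + k) t) :=
  .of_norm_bounded ((summable_inv_sq_add hα).mul_left (t ^ 2))
    fun k ↦ norm_levyTerm_le (by positivity) t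

lemma integral_bdcfIntegrand {α : ℝ} (hα : 0 < α) (t : ℝ) :
    ∫ x in Set.Ioi (0 : ℝ), bdcfIntegrand α t x = ∑' k : ℕ, levyTerm (α + k) t := by
  have hβ (k : ℕ) : 0 < α + k := by positivity
  have hint (k : ℕ) := integral_compensated_exp (hβ k) t
  have hsq (k : ℕ) : IntegrableOn (fun x : ℝ ↦ x ^ 2 * Real.exp (-((α + k) * x))) (Set.Ioi 0) ∧
      ∫ x in Set.Ioi (0 : ℝ), x ^ 2 * Real.exp (-((α + k) * x)) = 2 / (α + k) ^ 3 := by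
    constructor
    · have := integrableOn_rpow_mul_exp_neg_mul_rpow (p := 1) (s := 2) (b := α + k)
        (by norm_num) one_pos (hβ k)
      refine this.congr (ae_of_all _ fun x ↦ ?_)
      simp only [Real.rpow_one, neg_mul, Real.rpow_ofNat]
    · have := Real.integral_rpow_mul_exp_neg_mul_Ioi (a := 3) (r := α + k) (by norm_num) (hβ k)
      norm_num at this
      rw [this]
      ring
  have hsum := hasSum_integral_of_summable_integral_norm
    (μ := volume.restrict (Set.Ioi (0 : ℝ))) (fun k ↦ (hint k).1) (by
      refine .of_nonneg_of_le (fun k ↦ integral_nonneg fun x ↦ norm_nonneg _) (fun k ↦ ?_)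
        -- The factor `6` is `3` from the bound on the kernel times `2` from `∫ x² e^{-βx} dx = 2 /
        -- β³`.
        ((summable_inv_sq_add hα).mul_left (6 * t ^ 2))
      calc _ ≤ ∫ x in Set.Ioi (0 : ℝ), 3 * t ^ 2 * (α + k) *
            (x ^ 2 * Real.exp (-((α + k) * x))) := by
            refine integral_mono (hint k).1.norm ((hsq k).1.const_mul _) fun x ↦ ?_
            have := norm_exp_sub_one_add_le (t * x)
            push_cast at this
            rw [← mul_assoc] at this
            simp only [norm_mul ((_ : ℂ) + _), Complex.norm_real]
            rw [Real.norm_of_nonneg (by have := hβ k; positivity)]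
            calc _ ≤ 3 * (t * x) ^ 2 * ((α + k) * Real.exp (-((α + k) * x))) := by
                  have := hβ k
                  gcongr
              _ = _ := by ring
        _ = _ := by
          rw [integral_const_mul, (hsq k).2]
          have := hβ k
          field_simp
          ring)
  simp_rw [(hint _).2] at hsum
  rw [hsum.tsum_eq]
  refine setIntegral_congr_fun measurableSet_Ioi fun x hx ↦ ?_
  rw [tsum_mul_left, ← Complex.ofReal_tsum, (hasSum_exp_mul_hFun α hx).tsum_eq, bdcfIntegrand]

/-! ### The characteristic function of `log γ` and the Weierstrass product -/

/-- This is `𝔼 γ^{it}`, a Mellin transform of the gamma density, hence an Euler integral. -/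
lemma charFun_logGammaLaw {α lam : ℝ} (hα : 0 < α) (hlam : 0 < lam) (t : ℝ) :
    charFun (logGammaLaw α lam) t = Complex.exp (-(Complex.I * t * Real.log lam)) *
      (Complex.Gamma (α + Complex.I * t) / Complex.Gamma α) := by
  have hm : Measurable fun x ↦ gammaPDF α lam x :=
    (measurable_gammaPDFReal α lam).ennreal_ofReal
  rw [charFun_apply_real, logGammaLaw, integral_map Real.measurable_log.aemeasurable
    (by fun_prop), gammaMeasure, integral_withDensity_eq_integral_toReal_smul hm
    (ae_of_all _ fun x ↦ by simp [gammaPDF])]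
  have h1 : ∀ x : ℝ, x ∉ Set.Ici 0 → (gammaPDF α lam x).toReal •
      Complex.exp (t * (Real.log x : ℂ) * Complex.I) = 0 := by
    intro x hx
    rw [gammaPDF_of_neg (by simpa using hx)]
    simp
  rw [← setIntegral_eq_integral_of_forall_compl_eq_zero h1, integral_Ici_eq_integral_Ioi]
  have hre : 0 < ((α : ℂ) + Complex.I * t).re := by simp [hα]
  have hG : Complex.Gamma α ≠ 0 := by
    rw [Complex.Gamma_ofReal]; exact_mod_cast (Real.Gamma_pos_of_pos hα).ne'
  have hl : (lam : ℂ) ≠ 0 := by exact_mod_cast hlam.ne'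
  have key := Complex.integral_cpow_mul_exp_neg_mul_Ioi hre hlam
  have e : ∀ x ∈ Set.Ioi (0 : ℝ), (gammaPDF α lam x).toReal •
      Complex.exp (t * (Real.log x : ℂ) * Complex.I) = ((lam : ℂ) ^ (α : ℂ) / Complex.Gamma α) *
      ((x : ℂ) ^ ((α : ℂ) + Complex.I * t - 1) * Complex.exp (-(lam * x))) := by
    intro x (hx : 0 < x)
    have hx' : (x : ℂ) ≠ 0 := by exact_mod_cast hx.ne'
    rw [gammaPDF_of_nonneg hx.le, ENNReal.toReal_ofReal (by
      have := Real.Gamma_pos_of_pos hα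
      positivity), Complex.real_smul]
    push_cast
    rw [Complex.ofReal_cpow hlam.le, Complex.ofReal_cpow hx.le, ← Complex.Gamma_ofReal,
      show (α : ℂ) + Complex.I * t - 1 = ((α - 1 : ℝ) : ℂ) + Complex.I * t by push_cast; ring,
      Complex.cpow_add _ _ hx', Complex.cpow_def_of_ne_zero hx' (Complex.I * t),
      ← Complex.ofReal_log hx.le]
    push_cast
    rw [show (Real.log x : ℂ) * (Complex.I * t) = t * Real.log x * Complex.I by ring]
    ring
  rw [setIntegral_congr_fun measurableSet_Ioi e, integral_const_mul, key]
  have e2 : ((1 : ℂ) / lam) ^ ((α : ℂ) + Complex.I * t) =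
      ((lam : ℂ) ^ (α : ℂ))⁻¹ * Complex.exp (-(Complex.I * t * Real.log lam)) := by
    rw [one_div, Complex.inv_cpow _ _ (by
      rw [Complex.arg_ofReal_of_nonneg hlam.le]; exact Real.pi_pos.ne), Complex.cpow_add _ _ hl,
      mul_inv, Complex.cpow_def_of_ne_zero hl (Complex.I * t), ← Complex.ofReal_log hlam.le,
      Complex.exp_neg]
    congr 3
    ring
  have hla : (lam : ℂ) ^ (α : ℂ) ≠ 0 := by simp [Complex.cpow_eq_zero_iff, hl]
  rw [e2]
  field_simp

/-- The logarithm of the `k`-th factor in the Weierstrass product of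
`t ↦ Γ(α + i t) / Γ(α)`, where `β = α + k`. -/
noncomputable def gammaLogFactor (β t : ℝ) : ℂ :=
  Complex.I * t / β - Complex.log (1 + Complex.I * t / β)

lemma one_add_I_mul_div_mem_slitPlane (β t : ℝ) :
    1 + Complex.I * t / β ∈ Complex.slitPlane := by
  left
  simp [Complex.div_ofReal_re]

lemma hasDerivAt_gammaLogFactor {β : ℝ} (hβ : 0 < β) (t : ℝ) :
    HasDerivAt (gammaLogFactor β) (Complex.I * (1 / β - 1 / (β + Complex.I * t))) t := by
  have h2 : (β : ℂ) ≠ 0 := by exact_mod_cast hβ.ne'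
  have h1 := ofReal_add_I_mul_ne_zero hβ t
  have a : HasDerivAt (fun t : ℝ ↦ Complex.I * t / β) (Complex.I / β) t := by
    simpa using ((hasDerivAt_id t).ofReal_comp.const_mul Complex.I).div_const (β : ℂ)
  have b := (a.const_add 1).clog_real (one_add_I_mul_div_mem_slitPlane β t)
  have h3 : 1 + Complex.I * t / β ≠ 0 := Complex.slitPlane_ne_zero
    (one_add_I_mul_div_mem_slitPlane β t)
  have e : Complex.I * (1 / β - 1 / (β + Complex.I * t)) =
      Complex.I / β - Complex.I / β / (1 + Complex.I * t / β) := by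
    rw [show 1 + Complex.I * t / β = (β + Complex.I * t) / β by field_simp]
    field_simp
  rw [e]
  exact a.sub b

lemma exp_gammaLogFactor {β : ℝ} (hβ : 0 < β) (t : ℝ) :
    Complex.exp (gammaLogFactor β t) =
      Complex.exp (Complex.I * t / β) * (β / (β + Complex.I * t)) := by
  have h2 : (β : ℂ) ≠ 0 := by exact_mod_cast hβ.ne'
  have h3 : 1 + Complex.I * t / β ≠ 0 := Complex.slitPlane_ne_zero
    (one_add_I_mul_div_mem_slitPlane β t)
  have h1 := ofReal_add_I_mul_ne_zero hβ t
  rw [gammaLogFactor, Complex.exp_sub, Complex.exp_log h3]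
  field_simp

/-- Comparison with the harmonic sum, whose defect from `log n` tends to Euler's constant. The limit
is only later identified as `Ψ(α)`. There are `n + 1` terms to match the factors of
`Complex.GammaSeq`. -/
lemma exists_tendsto_log_sub_sum_inv {α : ℝ} (hα : 0 < α) :
    ∃ d : ℝ, Tendsto (fun n : ℕ ↦ Real.log n - ∑ j ∈ Finset.range (n + 1), 1 / (α + j))
      atTop (𝓝 d) := by
  have hs : Summable (fun j : ℕ ↦ 1 / ((j : ℝ) + 1) - 1 / (α + j)) := by
    refine .of_norm_bounded (((summable_inv_sq_add one_pos).add (summable_inv_sq_add hα)).mul_left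
      |α - 1|) fun j ↦ ?_
    have h1 : (0 : ℝ) < j + 1 := by positivity
    have h2 : 0 < α + j := by positivity
    have : 1 / ((j : ℝ) + 1) - 1 / (α + j) = (α - 1) * (1 / (j + 1) * (1 / (α + j))) := by
      field_simp; ring
    rw [this, norm_mul, Real.norm_eq_abs, Real.norm_of_nonneg (by positivity), add_comm 1 (j : ℝ)]
    gcongr
    have := sq_nonneg (1 / ((j : ℝ) + 1) - 1 / (α + j))
    have p : 0 ≤ 1 / ((j : ℝ) + 1) * (1 / (α + j)) := by positivity
    rw [← one_div_pow, ← one_div_pow]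
    nlinarith
  have h1 := hs.hasSum.tendsto_sum_nat
  have h2 := Real.tendsto_harmonic_sub_log
  have h3 : Tendsto (fun n : ℕ ↦ 1 / (α + n)) atTop (𝓝 0) := by
    simp_rw [one_div]
    exact (tendsto_atTop_add_const_left _ _ tendsto_natCast_atTop_atTop).inv_tendsto_atTop
  refine ⟨_, ((h1.sub h2).sub h3).congr fun n ↦ ?_⟩
  rw [Finset.sum_range_succ, Finset.sum_sub_distrib, harmonic]
  push_cast
  simp only [one_div]
  ring

/-- Divide Euler's limit formulas at `α + it` and at `α`, and insert the convergence factors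
`e^{it/(α+k)}`. Derivatives of the logarithmic factors are `O((α+k)^{-2})` on bounded intervals, so
the series may be differentiated termwise. -/
lemma exists_Gamma_div_Gamma_eq_exp {α : ℝ} (hα : 0 < α) :
    (∀ t, Summable fun k : ℕ ↦ gammaLogFactor (α + k) t) ∧
    (∀ t : ℝ, HasDerivAt (fun t ↦ ∑' k : ℕ, gammaLogFactor (α + k) t)
      (∑' k : ℕ, Complex.I * (1 / ((α + k : ℝ) : ℂ) - 1 / (((α + k : ℝ) : ℂ) + Complex.I * t))) t) ∧
    ∃ d : ℝ, ∀ t : ℝ, Complex.Gamma (α + Complex.I * t) / Complex.Gamma α =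
      Complex.exp (Complex.I * t * d + ∑' k : ℕ, gammaLogFactor (α + k) t) := by
  have hβ (k : ℕ) : 0 < α + k := by positivity
  have hG : Complex.Gamma α ≠ 0 := by
    rw [Complex.Gamma_ofReal]; exact_mod_cast (Real.Gamma_pos_of_pos hα).ne'
  have hzero (k : ℕ) : gammaLogFactor (α + k) 0 = 0 := by simp [gammaLogFactor]
  have hbd (R : ℝ) (k : ℕ) (y : ℝ) (hy : y ∈ Set.Ioo (-R) R) :
      ‖Complex.I * (1 / ((α + k : ℝ) : ℂ) - 1 / (((α + k : ℝ) : ℂ) + Complex.I * y))‖ ≤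
        R * (1 / (α + k) ^ 2) := by
    rw [norm_mul, Complex.norm_I, one_mul]
    refine (norm_inv_sub_inv_le (hβ k) y).trans ?_
    gcongr
    exact (abs_lt.2 hy).le
  have hR (t : ℝ) : (0 : ℝ) ∈ Set.Ioo (-(|t| + 1)) (|t| + 1) ∧
      t ∈ Set.Ioo (-(|t| + 1)) (|t| + 1) := by
    have := abs_nonneg t
    exact ⟨⟨by linarith, by linarith⟩, ⟨by linarith [neg_abs_le t], by linarith [le_abs_self t]⟩⟩
  have hsummable (t : ℝ) : Summable fun k : ℕ ↦ gammaLogFactor (α + k) t :=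
    summable_of_summable_hasDerivAt_of_isPreconnected
      ((summable_inv_sq_add hα).mul_left (|t| + 1)) isOpen_Ioo isPreconnected_Ioo
      (fun k y _ ↦ hasDerivAt_gammaLogFactor (hβ k) y) (hbd _) (hR t).1
      (by simp_rw [hzero]; exact summable_zero) (hR t).2
  refine ⟨hsummable, fun t ↦ ?_, ?_⟩
  · exact hasDerivAt_tsum_of_isPreconnected ((summable_inv_sq_add hα).mul_left (|t| + 1))
      isOpen_Ioo isPreconnected_Ioo (fun k y _ ↦ hasDerivAt_gammaLogFactor (hβ k) y)
      (hbd _) (hR t).1 (by simp_rw [hzero]; exact summable_zero) (hR t).2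
  obtain ⟨d, hd⟩ := exists_tendsto_log_sub_sum_inv hα
  refine ⟨d, fun t ↦ ?_⟩
  have l1 := (Complex.GammaSeq_tendsto_Gamma (α + Complex.I * t)).div
    (Complex.GammaSeq_tendsto_Gamma α) hG
  have l2 : Tendsto (fun n : ℕ ↦ Complex.exp (Complex.I * t *
      ((Real.log n - ∑ j ∈ Finset.range (n + 1), 1 / (α + j) : ℝ) : ℂ) +
      ∑ k ∈ Finset.range (n + 1), gammaLogFactor (α + k) t)) atTop
      (𝓝 (Complex.exp (Complex.I * t * d + ∑' k : ℕ, gammaLogFactor (α + k) t))) := by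
    refine (Complex.continuous_exp.tendsto _).comp (Tendsto.add ?_ ?_)
    · exact (((Complex.continuous_ofReal.tendsto d).comp hd)).const_mul _
    · exact (hsummable t).hasSum.tendsto_sum_nat.comp (tendsto_add_atTop_nat 1)
  -- For `n ≠ 0` the two sequences coincide exactly, so only algebra remains.
  refine tendsto_nhds_unique l1 (l2.congr' ?_)
  filter_upwards [eventually_ne_atTop 0] with n hn
  have hn' : (n : ℂ) ≠ 0 := by exact_mod_cast hn
  have hp : ∀ s : ℝ, ∏ j ∈ Finset.range (n + 1), ((α : ℂ) + Complex.I * s + j) ≠ 0 := fun s ↦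
    Finset.prod_ne_zero_iff.2 fun j _ ↦ by
      have := ofReal_add_I_mul_ne_zero (hβ j) s
      push_cast at this
      rwa [add_right_comm] at this
  have hp0 := hp 0
  simp only [Complex.ofReal_zero, mul_zero, add_zero] at hp0
  have hpow : (n : ℂ) ^ (α : ℂ) ≠ 0 := by simp [Complex.cpow_eq_zero_iff, hn']
  have hfac : (n.factorial : ℂ) ≠ 0 := by exact_mod_cast n.factorial_ne_zero
  simp only [Pi.div_apply, Complex.GammaSeq]
  rw [Complex.exp_add, Complex.exp_sum, Complex.cpow_add _ _ hn']
  simp_rw [exp_gammaLogFactor (hβ _)]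
  rw [Finset.prod_mul_distrib, ← Complex.exp_sum, ← mul_assoc, ← Complex.exp_add,
    Finset.prod_div_distrib, Complex.cpow_def_of_ne_zero hn' (Complex.I * t)]
  have e1 : Complex.I * t * ((Real.log n - ∑ j ∈ Finset.range (n + 1), 1 / (α + j) : ℝ) : ℂ) +
      ∑ j ∈ Finset.range (n + 1), Complex.I * t / ((α + j : ℝ) : ℂ) =
      Complex.log n * (Complex.I * t) := by
    push_cast
    rw [mul_sub, Finset.mul_sum]
    simp only [mul_one_div]
    ring
  rw [e1]
  push_cast
  have e2 : ∏ j ∈ Finset.range (n + 1), ((α : ℂ) + j + Complex.I * t) =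
      ∏ j ∈ Finset.range (n + 1), ((α : ℂ) + Complex.I * t + j) :=
    Finset.prod_congr rfl fun j _ ↦ add_right_comm _ _ _
  have hpt := hp t
  rw [e2]
  field_simp

/-- The exponent in `logGammaBDCF`, with the integral expanded into a series. -/
noncomputable def logGammaExponent (α lam t : ℝ) : ℂ :=
  Complex.I * t * (-(Real.log lam : ℂ) + Complex.digamma (α : ℂ))
    + ∑' k : ℕ, levyTerm (α + k) t

lemma logGammaBDCF_eq {α : ℝ} (hα : 0 < α) (lam t : ℝ) :
    logGammaBDCF α lam t = Complex.exp (logGammaExponent α lam t) := by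
  rw [logGammaBDCF, integral_bdcfIntegrand hα, logGammaExponent]

lemma hasDerivAt_I_mul_mul (c : ℂ) (t : ℝ) :
    HasDerivAt (fun t : ℝ ↦ Complex.I * t * c) (Complex.I * c) t := by
  simpa using ((hasDerivAt_id t).ofReal_comp.const_mul Complex.I).mul_const c

/-- The Weierstrass product for `t ↦ Γ(α + i t) / Γ(α)`. -/
lemma exists_digamma_eq_and_Gamma_div_Gamma_eq {α : ℝ} (hα : 0 < α) :
    ∃ d : ℝ, (d : ℂ) = Complex.digamma α ∧
      ∀ t : ℝ, Complex.Gamma (α + Complex.I * t) / Complex.Gamma α =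
        Complex.exp (Complex.I * t * d + ∑' k : ℕ, gammaLogFactor (α + k) t) := by
  obtain ⟨-, hder, d, hd⟩ := exists_Gamma_div_Gamma_eq_exp hα
  refine ⟨d, ?_, hd⟩
  have hG : Complex.Gamma α ≠ 0 := by
    rw [Complex.Gamma_ofReal]; exact_mod_cast (Real.Gamma_pos_of_pos hα).ne'
  have hdg : HasDerivAt (fun t : ℝ ↦ Complex.Gamma (α + Complex.I * t) / Complex.Gamma α)
      (deriv Complex.Gamma α * Complex.I / Complex.Gamma α) 0 := by
    have h1 : HasDerivAt Complex.Gamma (deriv Complex.Gamma α)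
        ((α : ℂ) + Complex.I * (0 : ℝ)) := by
      simp only [Complex.ofReal_zero, mul_zero, add_zero]
      refine (Complex.differentiableAt_Gamma _ fun m h ↦ ?_).hasDerivAt
      have := congrArg Complex.re h
      simp at this
      have hm : (0 : ℝ) ≤ m := m.cast_nonneg
      linarith
    have h2 : HasDerivAt (fun t : ℝ ↦ (α : ℂ) + Complex.I * t) Complex.I 0 := by
      simpa using ((hasDerivAt_id (0 : ℝ)).ofReal_comp.const_mul Complex.I).const_add (α : ℂ)
    exact (h1.comp (0 : ℝ) h2).div_const _
  have hde := ((hasDerivAt_I_mul_mul d 0).add (hder 0)).cexp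
  -- Compare derivatives at `0`: the left side gives `i Γ'(α) / Γ(α)`, the right side `i d`, since
  -- every factor of the product has zero derivative there.
  have := hdg.unique (hde.congr_of_eventuallyEq (Eventually.of_forall hd))
  simp [gammaLogFactor] at this
  rw [Complex.digamma_def, logDeriv_apply]
  have hI := Complex.I_ne_zero
  field_simp at this ⊢
  exact this.symm

/-- `φ` is the exponential of a differentiable series; multiplying the derivative of its `k`-th term
by `t` produces exactly `levyTerm (α + k) t`. -/
lemma hasDerivAt_charFun_logGammaLaw {α lam : ℝ} (hα : 0 < α) (hlam : 0 < lam) :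
    ∃ φ' : ℝ → ℂ, (∀ t, HasDerivAt (charFun (logGammaLaw α lam)) (φ' t) t) ∧
      (∀ t, t * φ' t = logGammaExponent α lam t * charFun (logGammaLaw α lam) t) ∧
      ∀ t, charFun (logGammaLaw α lam) t ≠ 0 := by
  obtain ⟨-, hder, -⟩ := exists_Gamma_div_Gamma_eq_exp hα
  obtain ⟨d, hdd, hd⟩ := exists_digamma_eq_and_Gamma_div_Gamma_eq hα
  have hφ : charFun (logGammaLaw α lam) = fun t : ℝ ↦ Complex.exp
      (Complex.I * t * (-(Real.log lam : ℂ) + Complex.digamma α) +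
        ∑' k : ℕ, gammaLogFactor (α + k) t) := by
    ext t
    rw [charFun_logGammaLaw hα hlam, hd, ← Complex.exp_add, hdd]
    congr 1
    ring
  rw [hφ]
  refine ⟨_, fun t ↦ ((hasDerivAt_I_mul_mul _ t).add (hder t)).cexp, fun t ↦ ?_,
    fun t ↦ Complex.exp_ne_zero _⟩
  rw [mul_left_comm, mul_comm]
  congr 1
  rw [logGammaExponent, mul_add, ← tsum_mul_left]
  congr 1
  · ring
  · refine tsum_congr fun k ↦ ?_
    rw [levyTerm_eq]
    ring

/-! ### Exponents of one-parameter semigroups -/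

section Semigroup

/-- The one-sided derivative at `t = 0` removes the `2πi` ambiguity of the logarithm. -/
lemma eq_of_forall_exp_mul_eq {a b : ℂ}
    (h : ∀ t : ℝ≥0, Complex.exp (t * a) = Complex.exp (t * b)) : a = b := by
  have hd (c : ℂ) : HasDerivWithinAt (fun t : ℝ ↦ Complex.exp (t * c)) c (Set.Ici 0) 0 := by
    have := (((hasDerivAt_id (0 : ℝ)).ofReal_comp.mul_const c).cexp).hasDerivWithinAt
      (s := Set.Ici 0)
    simpa using this
  refine (uniqueDiffOn_Ici (0 : ℝ) 0 Set.self_mem_Ici).eq_deriv _ (hd a)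
    ((hd b).congr (fun t ht ↦ ?_) (by simp))
  exact h ⟨t, ht⟩

lemma continuous_of_semigroup {g : ℝ≥0 → ℂ} (hadd : ∀ s t, g (s + t) = g s * g t)
    (hbd : ∀ t, ‖g t‖ ≤ 1) (hlim : Tendsto g (𝓝 0) (𝓝 1)) : Continuous g := by
  have key : ∀ s t : ℝ≥0, ‖g (s + t) - g s‖ ≤ ‖g t - 1‖ := fun s t ↦ by
    rw [hadd, show g s * g t - g s = g s * (g t - 1) by ring, norm_mul]
    exact mul_le_of_le_one_left (norm_nonneg _) (hbd s)
  rw [Metric.continuous_iff]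
  intro t ε hε
  obtain ⟨δ, hδ, h⟩ := Metric.tendsto_nhds_nhds.1 hlim ε hε
  refine ⟨δ, hδ, fun s hs ↦ ?_⟩
  rw [NNReal.dist_eq] at hs
  rcases le_total s t with hst | hst
  · have := @h (t - s) (by
      rw [NNReal.dist_eq, NNReal.coe_sub hst, NNReal.coe_zero, sub_zero, abs_sub_comm]
      exact hs)
    rw [dist_comm, dist_eq_norm]
    calc _ = ‖g (s + (t - s)) - g s‖ := by rw [add_tsub_cancel_of_le hst]
      _ ≤ _ := key _ _
      _ < ε := by rwa [dist_eq_norm] at this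
  · have := @h (s - t) (by
      rw [NNReal.dist_eq, NNReal.coe_sub hst, NNReal.coe_zero, sub_zero]
      exact hs)
    rw [dist_eq_norm]
    calc _ = ‖g (t + (s - t)) - g t‖ := by rw [add_tsub_cancel_of_le hst]
      _ ≤ _ := key _ _
      _ < ε := by rwa [dist_eq_norm] at this

/-- Integrating the semigroup law over `[0, a]` gives `g(s) F(a) = F(s + a) - F(s)`, where `F` is
the primitive of `g`. So `g` is differentiable and solves a linear equation. The explicit rate makes
its continuity in a parameter visible. -/
lemma exp_of_semigroup {g : ℝ≥0 → ℂ} (hadd : ∀ s t, g (s + t) = g s * g t)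
    (hg : Continuous g) {a : ℝ≥0}
    (hF : ∫ x in (0 : ℝ)..a, g x.toNNReal ≠ 0) (t : ℝ≥0) :
    g t = Complex.exp (t * ((g a - 1) / ∫ x in (0 : ℝ)..a, g x.toNNReal)) := by
  have hg' : Continuous fun x : ℝ ↦ g x.toNNReal := hg.comp continuous_real_toNNReal
  set F : ℝ → ℂ := fun b ↦ ∫ x in (0 : ℝ)..b, g x.toNNReal with hFdef
  change F a ≠ 0 at hF
  change g t = Complex.exp (t * ((g a - 1) / F a))
  set η := (g a - 1) / F a
  have hFd (b : ℝ) : HasDerivAt F (g b.toNNReal) b := (hg'.integral_hasStrictDerivAt 0 b).hasDerivAt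
  have hmul (s : ℝ≥0) : g s * F a = F (s + a) - F s := by
    have h1 : F (s + a) - F s = ∫ x in (s : ℝ)..(s + a), g x.toNNReal :=
      intervalIntegral.integral_interval_sub_left (hg'.intervalIntegrable _ _)
        (hg'.intervalIntegrable _ _)
    have h2 := intervalIntegral.integral_comp_add_left (a := 0) (b := a)
      (fun x ↦ g x.toNNReal) (s : ℝ)
    rw [add_zero] at h2
    rw [h1, ← h2, hFdef, ← intervalIntegral.integral_const_mul]
    refine intervalIntegral.integral_congr fun x hx ↦ ?_
    rw [Set.uIcc_of_le (NNReal.coe_nonneg a)] at hx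
    rw [Real.toNNReal_add (NNReal.coe_nonneg s) hx.1, Real.toNNReal_coe, hadd]
  -- For `s ≥ 0` this is `g(s) F(a) e^{-sη}`, written through `F`, whose differentiability is known.
  set f : ℝ → ℂ := fun s ↦ (F (s + a) - F s) * Complex.exp (-(s * η)) with hf
  have hder (s : ℝ) (hs : 0 ≤ s) : HasDerivAt f 0 s := by
    have h1 : HasDerivAt (fun s ↦ F (s + a) - F s) (g (s + a).toNNReal - g s.toNNReal) s := by
      refine HasDerivAt.sub ?_ (hFd s)
      simpa using (hFd (s + a)).comp_add_const s a
    have h2 : HasDerivAt (fun s : ℝ ↦ Complex.exp (-(s * η)))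
        (Complex.exp (-(s * η)) * (-(1 * η))) s :=
      (((hasDerivAt_id s).ofReal_comp.mul_const η).neg).cexp
    refine (h1.mul h2).congr_deriv ?_
    lift s to ℝ≥0 using hs
    rw [← hmul, Real.toNNReal_add (NNReal.coe_nonneg s) (NNReal.coe_nonneg a), Real.toNNReal_coe,
      Real.toNNReal_coe, hadd]
    simp only [η]
    field_simp
    ring
  have hconst := constant_of_has_deriv_right_zero (f := f) (a := 0) (b := t)
    (fun s hs ↦ (hder s hs.1).continuousAt.continuousWithinAt)
    (fun s hs ↦ (hder s hs.1).hasDerivWithinAt) t ⟨t.2, le_rfl⟩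
  have hF0 : F 0 = 0 := by simp [hFdef]
  simp only [hf, hF0, zero_add, Complex.ofReal_zero, zero_mul, neg_zero, Complex.exp_zero,
    mul_one, sub_zero] at hconst
  rw [← hmul, Complex.exp_neg] at hconst
  have he := Complex.exp_ne_zero (t * η)
  field_simp at hconst
  exact hconst

/-- A continuous one-parameter semigroup of characteristic functions has a continuous
characteristic exponent. -/
lemma exists_exponent_of_semigroup {g : ℝ≥0 → ℝ → ℂ} (h0 : ∀ θ, g 0 θ = 1)
    (hadd : ∀ s t θ, g (s + t) θ = g s θ * g t θ) (hbd : ∀ t θ, ‖g t θ‖ ≤ 1)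
    (hlim : ∀ θ, Tendsto (fun t ↦ g t θ) (𝓝 0) (𝓝 1)) (hcont : ∀ t, Continuous (g t)) :
    ∃ η : ℝ → ℂ, Continuous η ∧ ∀ t θ, g t θ = Complex.exp (t * η θ) := by
  have hc (θ : ℝ) : Continuous fun t ↦ g t θ :=
    continuous_of_semigroup (fun s t ↦ hadd s t θ) (fun t ↦ hbd t θ) (hlim θ)
  have hc' (θ : ℝ) : Continuous fun x : ℝ ↦ g x.toNNReal θ := (hc θ).comp continuous_real_toNNReal
  have hFc (a : ℝ) : Continuous fun θ ↦ ∫ x in (0 : ℝ)..a, g x.toNNReal θ :=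
    intervalIntegral.continuous_of_dominated_interval (bound := fun _ ↦ 1)
      (fun θ ↦ (hc' θ).aestronglyMeasurable) (fun θ ↦ ae_of_all _ fun x _ ↦ hbd _ _)
      intervalIntegrable_const (ae_of_all _ fun x _ ↦ hcont _)
  have hex (θ : ℝ) : ∃ a : ℝ≥0, ∫ x in (0 : ℝ)..a, g x.toNNReal θ ≠ 0 := by
    have hd : HasDerivAt (fun b ↦ ∫ x in (0 : ℝ)..b, g x.toNNReal θ) 1 0 := by
      simpa [h0] using ((hc' θ).integral_hasStrictDerivAt 0 0).hasDerivAt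
    have hev : ∀ᶠ b in 𝓝[>] (0 : ℝ), ∫ x in (0 : ℝ)..b, g x.toNNReal θ ≠ 0 :=
      (hd.eventually_ne (c := 0) one_ne_zero).filter_mono
        (nhdsWithin_mono 0 fun x hx ↦ (Set.mem_Ioi.1 hx).ne')
    obtain ⟨a, ha, ha0⟩ := (hev.and self_mem_nhdsWithin).exists
    exact ⟨⟨a, le_of_lt ha0⟩, ha⟩
  choose a ha using hex
  set η : ℝ → ℂ := fun θ ↦ (g (a θ) θ - 1) / ∫ x in (0 : ℝ)..(a θ), g x.toNNReal θ with hη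
  have hexp (t : ℝ≥0) (θ : ℝ) : g t θ = Complex.exp (t * η θ) :=
    exp_of_semigroup (fun s t ↦ hadd s t θ) (hc θ) (ha θ) t
  refine ⟨η, continuous_iff_continuousAt.2 fun θ₀ ↦ ?_, hexp⟩
  -- The chosen `a θ` need not depend continuously on `θ`. Freezing it at `a θ₀` works for all
  -- nearby `θ` and gives the same exponent, by uniqueness.
  have hev : ∀ᶠ θ in 𝓝 θ₀, ∫ x in (0 : ℝ)..(a θ₀), g x.toNNReal θ ≠ 0 :=
    (hFc _).continuousAt.eventually_ne (ha θ₀)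
  have hcA : ContinuousAt (fun θ ↦ (g (a θ₀) θ - 1) / ∫ x in (0 : ℝ)..(a θ₀), g x.toNNReal θ) θ₀ :=
    ((hcont _).continuousAt.sub continuousAt_const).div (hFc _).continuousAt (ha θ₀)
  refine hcA.congr (hev.mono fun θ hθ ↦ ?_)
  refine eq_of_forall_exp_mul_eq fun t ↦ ?_
  rw [← hexp]
  exact (exp_of_semigroup (fun s t ↦ hadd s t θ) (hc θ) hθ t).symm

end Semigroup

/-! ### Riemann sums and càdlàg bounds -/

section RiemannSum

lemma sum_mul_sub_eq {R : Type*} [CommRing R] (a y : ℕ → R) (m : ℕ) :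
    ∑ j ∈ Finset.range m, a j * (y (j + 1) - y j) =
      ∑ j ∈ Finset.range m, (a j - a (j + 1)) * y (j + 1) + a m * y m - a 0 * y 0 := by
  induction m with
  | zero => simp
  | succ m ih => rw [Finset.sum_range_succ, ih, Finset.sum_range_succ]; ring

/-- Riemann sums with right endpoints converge for bounded right-continuous integrands. -/
lemma tendsto_riemannSum {E : Type*} [NormedAddCommGroup E] [NormedSpace ℝ E]
    [CompleteSpace E] [SecondCountableTopology E] {w : ℝ → ℝ} (hw : Continuous w) {F : ℝ → E}
    {T C : ℝ} (hT : 0 < T) (hC : ∀ s ∈ Set.Icc 0 T, ‖F s‖ ≤ C)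
    (hF : ∀ s ∈ Set.Ico 0 T, ContinuousWithinAt F (Set.Ici s) s) :
    Tendsto (fun m : ℕ ↦ ∑ j ∈ Finset.range m,
      (∫ s in ((j : ℝ) * (T / m))..(((j + 1 : ℕ) : ℝ) * (T / m)), w s) •
        F (((j + 1 : ℕ) : ℝ) * (T / m)))
      atTop (𝓝 (∫ s in (0 : ℝ)..T, w s • F s)) := by
  let : MeasurableSpace E := borel E
  have : BorelSpace E := ⟨rfl⟩
  -- `G m s` is `F` at the right end of the grid cell containing `s`. That point lies strictly
  -- beyond `s`, so right-continuity suffices for pointwise convergence, and dominated convergence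
  -- applies.
  set G : ℕ → ℝ → E := fun m s ↦ F (((⌊s / (T / m)⌋₊ + 1 : ℕ) : ℝ) * (T / m)) with hG
  have hGm (m : ℕ) : StronglyMeasurable (G m) := by
    have h1 : Measurable fun k : ℕ ↦ F (((k + 1 : ℕ) : ℝ) * (T / m)) := measurable_from_nat
    exact (h1.comp (Nat.measurable_floor.comp (measurable_id.div_const _))).stronglyMeasurable
  have hstep {m : ℕ} (hm : m ≠ 0) : 0 < T / m := by positivity
  have hbounds {m : ℕ} (hm : m ≠ 0) {s : ℝ} (hs : s ∈ Set.Ico 0 T) :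
      s < ((⌊s / (T / m)⌋₊ + 1 : ℕ) : ℝ) * (T / m) ∧
      ((⌊s / (T / m)⌋₊ + 1 : ℕ) : ℝ) * (T / m) ≤ s + T / m ∧
      ((⌊s / (T / m)⌋₊ + 1 : ℕ) : ℝ) * (T / m) ≤ T := by
    have hh := hstep hm
    have hm' : (0 : ℝ) < m := by positivity
    have hs0 : 0 ≤ s / (T / m) := div_nonneg hs.1 hh.le
    refine ⟨?_, ?_, ?_⟩
    · have := Nat.lt_floor_add_one (s / (T / m))
      rw [div_lt_iff₀ hh] at this
      exact_mod_cast this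
    · have := Nat.floor_le hs0
      rw [le_div_iff₀ hh] at this
      push_cast
      linarith
    · have h1 : ⌊s / (T / m)⌋₊ < m := by
        rw [Nat.floor_lt hs0, div_lt_iff₀ hh, mul_div_cancel₀ _ hm'.ne']
        exact hs.2
      have h2 : ((⌊s / (T / m)⌋₊ + 1 : ℕ) : ℝ) ≤ m := by exact_mod_cast h1
      calc _ ≤ (m : ℝ) * (T / m) := by gcongr
        _ = T := mul_div_cancel₀ _ hm'.ne'
  have hlim : Tendsto (fun m ↦ ∫ s in (0 : ℝ)..T, w s • G m s) atTop
      (𝓝 (∫ s in (0 : ℝ)..T, w s • F s)) := by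
    -- At `s = T` the floor would select a cell beyond `[0, T]`, where `F` is not controlled.
    have hne : ∀ᵐ s : ℝ, s ≠ T := by
      rw [ae_iff]; simp
    refine intervalIntegral.tendsto_integral_filter_of_dominated_convergence
      (fun s ↦ |w s| * C) (Eventually.of_forall fun m ↦
        (hw.stronglyMeasurable.smul (hGm m)).aestronglyMeasurable) ?_
      ((hw.abs.mul continuous_const).intervalIntegrable _ _) ?_
    · filter_upwards [eventually_ne_atTop 0] with m hm
      filter_upwards [hne] with s hs hs'
      rw [Set.uIoc_of_le hT.le] at hs'
      have hs2 : s ∈ Set.Ico 0 T := ⟨hs'.1.le, lt_of_le_of_ne hs'.2 hs⟩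
      obtain ⟨b1, b2, b3⟩ := hbounds hm hs2
      rw [norm_smul, Real.norm_eq_abs]
      exact mul_le_mul_of_nonneg_left (hC _ ⟨hs2.1.trans b1.le, b3⟩) (abs_nonneg _)
    · filter_upwards [hne] with s hs hs'
      rw [Set.uIoc_of_le hT.le] at hs'
      have hs2 : s ∈ Set.Ico 0 T := ⟨hs'.1.le, lt_of_le_of_ne hs'.2 hs⟩
      refine Tendsto.const_smul ?_ _
      refine (hF s hs2).tendsto.comp (tendsto_nhdsWithin_iff.2 ⟨?_, ?_⟩)
      · refine tendsto_of_tendsto_of_tendsto_of_le_of_le' tendsto_const_nhds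
          (h := fun m : ℕ ↦ s + T / m) ?_ ?_ ?_
        · simpa using (tendsto_const_div_atTop_nhds_zero_nat T).const_add s
        · filter_upwards [eventually_ne_atTop 0] with m hm using (hbounds hm hs2).1.le
        · filter_upwards [eventually_ne_atTop 0] with m hm using (hbounds hm hs2).2.1
      · filter_upwards [eventually_ne_atTop 0] with m hm using (hbounds hm hs2).1.le
  refine hlim.congr' ?_
  filter_upwards [eventually_ne_atTop 0] with m hm
  have hh := hstep hm
  have hm' : (m : ℝ) ≠ 0 := by positivity
  have hae (j : ℕ) : ∀ᵐ s : ℝ, s ∈ Set.uIoc ((j : ℝ) * (T / m)) (((j + 1 : ℕ) : ℝ) * (T / m)) →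
      w s • F (((j + 1 : ℕ) : ℝ) * (T / m)) = w s • G m s := by
    have hne : ∀ᵐ s : ℝ, s ≠ ((j + 1 : ℕ) : ℝ) * (T / m) := by
      rw [ae_iff]; simp
    filter_upwards [hne] with s hs hs'
    rw [Set.uIoc_of_le (by gcongr; simp)] at hs'
    have hfl : ⌊s / (T / m)⌋₊ = j := by
      rw [Nat.floor_eq_iff (div_nonneg (le_trans (by positivity) hs'.1.le) hh.le),
        le_div_iff₀ hh, div_lt_iff₀ hh]
      exact ⟨hs'.1.le, by exact_mod_cast lt_of_le_of_ne hs'.2 hs⟩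
    simp only [hG, hfl]
  have hsum := intervalIntegral.sum_integral_adjacent_intervals (μ := volume)
    (f := fun s ↦ w s • G m s) (a := fun j : ℕ ↦ (j : ℝ) * (T / m)) (n := m) fun j _ ↦ by
      refine IntervalIntegrable.congr_ae (f := fun s ↦ w s • F (((j + 1 : ℕ) : ℝ) * (T / m)))
        ((hw.smul continuous_const).intervalIntegrable _ _) ?_
      exact (ae_restrict_iff' measurableSet_uIoc).2 (hae j)
  simp only [Nat.cast_zero, zero_mul, mul_div_cancel₀ _ hm'] at hsum
  rw [← hsum]
  refine Finset.sum_congr rfl fun j _ ↦ ?_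
  rw [← intervalIntegral.integral_smul_const]
  exact (intervalIntegral.integral_congr_ae (hae j)).symm

/-- It differs from the right sum by the telescoping term `(T/m) (f 0 - f T)`, which vanishes in the
limit. -/
lemma tendsto_leftRiemannSum {f : ℝ → ℂ} (hf : Continuous f) {T : ℝ} (hT : 0 < T) :
    Tendsto (fun m : ℕ ↦ ∑ j ∈ Finset.range m, ((T / m : ℝ) : ℂ) * f ((j : ℝ) * (T / m)))
      atTop (𝓝 (∫ s in (0 : ℝ)..T, f s)) := by
  obtain ⟨C, hC⟩ := isCompact_Icc.exists_bound_of_continuousOn (s := Set.Icc 0 T) hf.continuousOn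
  have h1 := tendsto_riemannSum (w := fun _ ↦ 1) continuous_const hT hC
    fun s _ ↦ hf.continuousWithinAt
  have h2 : Tendsto (fun m : ℕ ↦ ((T / m : ℝ) : ℂ) * (f 0 - f T)) atTop (𝓝 0) := by
    have := (Complex.continuous_ofReal.tendsto 0).comp (tendsto_const_div_atTop_nhds_zero_nat T)
    simpa using this.mul_const (f 0 - f T)
  have h3 := h1.add h2
  simp only [one_smul, add_zero] at h3
  refine h3.congr' ?_
  filter_upwards [eventually_ne_atTop 0] with m hm
  have hm' : (m : ℝ) ≠ 0 := by positivity
  have h4 := Finset.sum_range_sub (fun j : ℕ ↦ f ((j : ℝ) * (T / m))) m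
  simp only [mul_div_cancel₀ _ hm', Nat.cast_zero, zero_mul] at h4
  rw [← Finset.mul_sum, ← neg_sub (f T), ← h4, Finset.sum_sub_distrib]
  simp only [intervalIntegral.integral_const, smul_eq_mul, mul_one]
  have h5 (j : ℕ) : (((j + 1 : ℕ) : ℝ) * (T / m) - (j : ℝ) * (T / m)) = T / m := by
    push_cast; ring
  simp only [h5, Complex.real_smul, ← Finset.mul_sum]
  ring

/-- One-sided limits bound the path near each point; compactness makes the bound global. -/
lemma exists_bound_of_cadlag {f : ℝ≥0 → ℝ}
    (hf : ∀ t, ContinuousWithinAt f (Set.Ici t) t ∧ ∃ l : ℝ, Tendsto f (𝓝[<] t) (𝓝 l))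
    (T : ℝ≥0) : ∃ C, ∀ t ∈ Set.Icc 0 T, ‖f t‖ ≤ C := by
  refine (isCompact_Icc (a := (0 : ℝ≥0)) (b := T)).induction_on
    (p := fun s ↦ ∃ C, ∀ t ∈ s, ‖f t‖ ≤ C) ⟨0, by simp⟩ ?_ ?_ ?_
  · rintro s t hst ⟨C, hC⟩
    exact ⟨C, fun x hx ↦ hC x (hst hx)⟩
  · rintro s t ⟨C, hC⟩ ⟨D, hD⟩
    refine ⟨max C D, fun x hx ↦ ?_⟩
    rcases hx with hx | hx
    · exact (hC x hx).trans (le_max_left _ _)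
    · exact (hD x hx).trans (le_max_right _ _)
  · intro t _
    obtain ⟨h1, l, h2⟩ := hf t
    have e1 : ∀ᶠ x in 𝓝[≥] t, ‖f x‖ < ‖f t‖ + 1 := h1.tendsto.norm.eventually_lt_const (by simp)
    have e2 : ∀ᶠ x in 𝓝[<] t, ‖f x‖ < ‖l‖ + 1 := h2.norm.eventually_lt_const (by simp)
    have e3 : ∀ᶠ x in 𝓝 t, ‖f x‖ ≤ max (‖f t‖ + 1) (‖l‖ + 1) := by
      rw [← nhdsLT_sup_nhdsGE, eventually_sup]
      exact ⟨e2.mono fun x hx ↦ hx.le.trans (le_max_right _ _),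
        e1.mono fun x hx ↦ hx.le.trans (le_max_left _ _)⟩
    exact ⟨_, mem_nhdsWithin_of_mem_nhds e3, _, fun x hx ↦ hx⟩

end RiemannSum

/-! ### Characteristic functions of a Lévy process and its exponential integral -/

section Levy

variable {Ω : Type*} [MeasurableSpace Ω] {P : Measure Ω}

lemma charFun_map_real {X : Ω → ℝ} (hX : AEMeasurable X P) (θ : ℝ) :
    charFun (P.map X) θ = ∫ ω, Complex.exp (θ * X ω * Complex.I) ∂P := by
  rw [charFun_apply_real, integral_map hX (by fun_prop)]

/-- Summation by parts turns the weights into `e^{-s_j} - e^{-s_{j+1}}`, the integral of `e^{-s}`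
over a cell. This links the pathwise definition to sums of independent increments. -/
lemma IsLevyProcess.tendsto_sum_increments {Y : ℝ≥0 → Ω → ℝ} (hY : IsLevyProcess Y P)
    {T : ℝ≥0} (hT : 0 < T) :
    ∀ᵐ ω ∂P, Tendsto (fun m : ℕ ↦ ∑ j ∈ Finset.range m, Real.exp (-((j : ℝ) * (T / m))) *
      (Y ((j + 1 : ℕ) * (T / m)) ω - Y (j * (T / m)) ω)) atTop (𝓝 (expIntegral Y T ω)) := by
  filter_upwards [hY.cadlag] with ω hω
  obtain ⟨C, hC⟩ := exists_bound_of_cadlag hω T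
  have hw : Continuous fun s : ℝ ↦ Real.exp (-s) := by fun_prop
  have key := tendsto_riemannSum hw (F := fun s ↦ Y s.toNNReal ω) (T := T) (C := C) hT
    (fun s hs ↦ hC _ ⟨zero_le, Real.toNNReal_le_iff_le_coe.2 hs.2⟩) (fun s hs ↦ by
      refine (hω s.toNNReal).1.comp (t := Set.Ici s.toNNReal)
        continuous_real_toNNReal.continuousWithinAt fun x hx ↦ ?_
      exact Real.toNNReal_le_toNNReal hx)
  have key2 := key.const_add (Real.exp (-(T : ℝ)) * Y T ω - Y 0 ω)
  refine key2.congr' ?_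
  filter_upwards [eventually_ne_atTop 0] with m hm
  have hm' : (m : ℝ≥0) ≠ 0 := by positivity
  have hm2 : (m : ℝ) ≠ 0 := by positivity
  have hcoe (j : ℕ) : ((j : ℝ) * (T / m)).toNNReal = j * (T / m) := by
    rw [← Real.toNNReal_coe (r := (j : ℝ≥0) * (T / m))]
    push_cast; rfl
  have habel := sum_mul_sub_eq (fun j : ℕ ↦ Real.exp (-((j : ℝ) * (T / m))))
    (fun j : ℕ ↦ Y (j * (T / m)) ω) m
  simp only [Nat.cast_zero, zero_mul, neg_zero, Real.exp_zero, one_mul, mul_div_cancel₀ _ hm',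
    mul_div_cancel₀ _ hm2] at habel
  rw [habel, add_sub_assoc, add_comm]
  congr 1
  refine Finset.sum_congr rfl fun j _ ↦ ?_
  rw [hcoe, smul_eq_mul]
  congr 1
  rw [intervalIntegral.integral_comp_neg (fun x ↦ Real.exp x), integral_exp]

lemma IsLevyProcess.aemeasurable_expIntegral_of_pos {Y : ℝ≥0 → Ω → ℝ}
    (hY : IsLevyProcess Y P) {T : ℝ≥0} (hT : 0 < T) :
    AEMeasurable (expIntegral Y T) P := by
  refine aemeasurable_of_tendsto_metrizable_ae atTop (fun m ↦ ?_) (hY.tendsto_sum_increments hT)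
  have := hY.measurable
  fun_prop

lemma IsLevyProcess.aemeasurable_expIntegral {Y : ℝ≥0 → Ω → ℝ} (hY : IsLevyProcess Y P) (T : ℝ≥0) :
    AEMeasurable (expIntegral Y T) P := by
  rcases eq_or_ne T 0 with rfl | hT
  · have : expIntegral Y 0 = fun _ ↦ 0 := by ext ω; simp [expIntegral]
    rw [this]
    exact aemeasurable_const
  · exact hY.aemeasurable_expIntegral_of_pos (pos_iff_ne_zero.2 hT)

variable [IsProbabilityMeasure P]

lemma tendsto_charFun_of_tendsto_ae {ι : Type*} {l : Filter ι} [l.IsCountablyGenerated]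
    {X : ι → Ω → ℝ} {Z : Ω → ℝ} (hX : ∀ i, AEMeasurable (X i) P) (hZ : AEMeasurable Z P)
    (h : ∀ᵐ ω ∂P, Tendsto (fun i ↦ X i ω) l (𝓝 (Z ω))) (θ : ℝ) :
    Tendsto (fun i ↦ charFun (P.map (X i)) θ) l (𝓝 (charFun (P.map Z) θ)) := by
  simp_rw [charFun_map_real (hX _), charFun_map_real hZ]
  refine tendsto_integral_filter_of_dominated_convergence (fun _ ↦ 1)
    (Eventually.of_forall fun i ↦ ?_) (Eventually.of_forall fun i ↦ ae_of_all _ fun ω ↦ ?_)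
    (integrable_const _) ?_
  · exact (Complex.measurable_exp.comp_aemeasurable
      (((Complex.measurable_ofReal.comp_aemeasurable (hX i)).const_mul (θ : ℂ)).mul_const
        Complex.I)).aestronglyMeasurable
  · rw [← Complex.ofReal_mul, Complex.norm_exp_ofReal_mul_I]
  · filter_upwards [h] with ω hω
    have hc : Continuous fun x : ℝ ↦ Complex.exp (θ * x * Complex.I) := by fun_prop
    exact (hc.tendsto _).comp hω

/-- Every subsequence has a further subsequence converging almost surely. -/
lemma tendsto_charFun_of_tendstoInMeasure {ι : Type*} {l : Filter ι} [l.IsCountablyGenerated]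
    {X : ι → Ω → ℝ} {Z : Ω → ℝ} (hX : ∀ i, AEMeasurable (X i) P) (hZ : AEMeasurable Z P)
    (h : TendstoInMeasure P X l Z) (θ : ℝ) :
    Tendsto (fun i ↦ charFun (P.map (X i)) θ) l (𝓝 (charFun (P.map Z) θ)) := by
  refine tendsto_of_subseq_tendsto fun ns hns ↦ ?_
  obtain ⟨ms, hms, hae⟩ := (h.comp hns).exists_seq_tendsto_ae'
  exact ⟨ms, tendsto_charFun_of_tendsto_ae (fun i ↦ hX _) hZ hae θ⟩

namespace IsLevyProcess

variable {Y : ℝ≥0 → Ω → ℝ}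

lemma charFun_zero (hY : IsLevyProcess Y P) (θ : ℝ) : charFun (P.map (Y 0)) θ = 1 := by
  rw [charFun_map_real (hY.measurable 0).aemeasurable,
    integral_congr_ae (g := fun _ ↦ (1 : ℂ))]
  · simp
  · filter_upwards [hY.start_zero] with ω hω
    simp [hω]

lemma charFun_add (hY : IsLevyProcess Y P) (s t : ℝ≥0) (θ : ℝ) :
    charFun (P.map (Y (s + t))) θ = charFun (P.map (Y s)) θ * charFun (P.map (Y t)) θ := by
  have hind := hY.indep_increments.indepFun_eval_sub zero_le (le_self_add (a := s) (b := t))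
    hY.start_zero
  have h := congrFun (hind.charFun_map_add_eq_mul (hY.measurable s).aemeasurable
    ((hY.measurable (s + t)).sub (hY.measurable s)).aemeasurable) θ
  rw [add_sub_cancel] at h
  rw [h, Pi.mul_apply, ← hY.stationary_increments s t]
  rfl

lemma exists_exponent (hY : IsLevyProcess Y P) :
    ∃ η : ℝ → ℂ, Continuous η ∧
      ∀ (t : ℝ≥0) θ, charFun (P.map (Y t)) θ = Complex.exp (t * η θ) := by
  have hp (t : ℝ≥0) : IsProbabilityMeasure (P.map (Y t)) :=
    Measure.isProbabilityMeasure_map (hY.measurable t).aemeasurable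
  refine exists_exponent_of_semigroup (g := fun t ↦ charFun (P.map (Y t))) hY.charFun_zero
    hY.charFun_add (fun t θ ↦ norm_charFun_le_one _) (fun θ ↦ ?_) (fun t ↦ continuous_charFun)
  rw [← hY.charFun_zero θ]
  refine tendsto_charFun_of_tendsto_ae (fun t ↦ (hY.measurable t).aemeasurable)
    (hY.measurable 0).aemeasurable ?_ θ
  filter_upwards [hY.cadlag] with ω hω
  have := (hω 0).1.tendsto
  rwa [show Set.Ici (0 : ℝ≥0) = Set.univ from Set.Ici_bot, nhdsWithin_univ] at this

/-- The characteristic function of `∫_{(0,T]} e^{-s} dY(s)`. -/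
lemma charFun_expIntegral (hY : IsLevyProcess Y P) {η : ℝ → ℂ} (hη : Continuous η)
    (hYη : ∀ (t : ℝ≥0) θ, charFun (P.map (Y t)) θ = Complex.exp (t * η θ)) {T : ℝ≥0} (hT : 0 < T)
    (θ : ℝ) : charFun (P.map (expIntegral Y T)) θ =
      Complex.exp (∫ s in (0 : ℝ)..T, η (θ * Real.exp (-s))) := by
  have hm := hY.measurable
  have h1 := tendsto_charFun_of_tendsto_ae (fun m ↦ by fun_prop)
    (hY.aemeasurable_expIntegral_of_pos hT) (hY.tendsto_sum_increments hT) θ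
  have hc : Continuous fun s ↦ η (θ * Real.exp (-s)) := by fun_prop
  have h2 := (Complex.continuous_exp.tendsto _).comp
    (tendsto_leftRiemannSum hc (T := T) (by exact_mod_cast hT))
  refine tendsto_nhds_unique h1 (h2.congr fun m ↦ ?_)
  have hmono : Monotone fun j : ℕ ↦ (j : ℝ≥0) * (T / m) := fun i j hij ↦ by
    simp only; gcongr
  have hind := (hY.indep_increments.nat hmono).comp
    (fun j x ↦ Real.exp (-((j : ℝ) * (T / m))) * x) (fun j ↦ by fun_prop)
  -- By independence and stationarity the characteristic function factors into the exponential of a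
  -- left Riemann sum of `η(θ e^{-s})`.
  have h3 := iIndepFun.charFun_map_fun_finsetSum_eq_prod (s := Finset.range m) (P := P)
    (X := fun (j : ℕ) ω ↦ Real.exp (-((j : ℝ) * (T / m))) *
      (Y ((j + 1 : ℕ) * (T / m)) ω - Y (j * (T / m)) ω)) (fun j _ ↦ by fun_prop)
    (iIndepFun.precomp (g := fun i : Finset.range m ↦ (i : ℕ)) Subtype.val_injective hind)
  rw [h3, Finset.prod_apply, Function.comp_apply, Complex.exp_sum]
  refine Finset.prod_congr rfl fun j _ ↦ ?_
  rw [charFun_map_mul_comp (by fun_prop)]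
  have h4 := hY.stationary_increments (j * (T / m)) (T / m)
  rw [← add_one_mul, ← Nat.cast_add_one] at h4
  rw [h4, hYη, mul_comm θ]
  push_cast
  rfl

end IsLevyProcess

end Levy

/-! ### The equation `η φ = θ φ'` -/

section Selfdecomposable

/-- If `φ(θ) = lim exp (∫_0^T η(θ e^{-s}) ds)` and `φ` is differentiable, then
`η(θ) φ(θ) = θ φ'(θ)`. -/
lemma exponent_mul_eq_of_tendsto {η φ φ' : ℝ → ℂ} (hη : Continuous η)
    (hφ : ∀ θ, HasDerivAt φ (φ' θ) θ)
    (hlim : ∀ θ, Tendsto (fun T : ℝ≥0 ↦ Complex.exp (∫ s in (0 : ℝ)..T, η (θ * Real.exp (-s))))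
      atTop (𝓝 (φ θ))) (θ : ℝ) : η θ * φ θ = θ * φ' θ := by
  have hc (θ : ℝ) : Continuous fun s ↦ η (θ * Real.exp (-s)) := by fun_prop
  set J : ℝ → ℂ := fun h ↦ ∫ s in (0 : ℝ)..h, η (θ * Real.exp (-s)) with hJ
  have hJd : HasDerivAt J (η θ) 0 := by
    simpa using ((hc θ).integral_hasStrictDerivAt 0 0).hasDerivAt
  -- Splitting `[0, h + T]` at `h`, the second piece is the same integral with `θ e^{-h}` in place
  -- of `θ`; then `T → ∞`.
  have hconst (h : ℝ≥0) : Complex.exp (J h) * φ (θ * Real.exp (-(h : ℝ))) = φ θ := by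
    have h1 := (hlim (θ * Real.exp (-(h : ℝ)))).const_mul (Complex.exp (J h))
    have h2 := (hlim θ).comp (tendsto_atTop_mono (fun T : ℝ≥0 ↦ le_add_self) tendsto_id :
      Tendsto (fun T ↦ h + T) atTop atTop)
    refine tendsto_nhds_unique h1 (h2.congr fun T ↦ ?_)
    simp only [Function.comp_apply]
    rw [← Complex.exp_add]
    congr 1
    have h3 := intervalIntegral.integral_comp_add_left (a := 0) (b := T)
      (fun s ↦ η (θ * Real.exp (-s))) (h : ℝ)
    rw [add_zero] at h3
    have h4 := intervalIntegral.integral_add_adjacent_intervals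
      ((hc θ).intervalIntegrable (μ := volume) 0 h) ((hc θ).intervalIntegrable h (h + T))
    rw [NNReal.coe_add, ← h4, ← h3]
    congr 1
    refine intervalIntegral.integral_congr fun s _ ↦ ?_
    rw [mul_assoc, ← Real.exp_add, neg_add]
  have hE : HasDerivAt (fun h : ℝ ↦ θ * Real.exp (-h)) (-θ) 0 := by
    simpa using ((hasDerivAt_neg (0 : ℝ)).exp.const_mul θ)
  have hφE : HasDerivAt (fun h : ℝ ↦ φ (θ * Real.exp (-h))) ((-θ : ℝ) • φ' θ) 0 := by
    have h5 : HasDerivAt φ (φ' θ) (θ * Real.exp (-0)) := by simpa using hφ θ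
    exact HasDerivAt.scomp (0 : ℝ) h5 hE
  have hg := hJd.cexp.mul hφE
  have hz : HasDerivWithinAt (fun h ↦ Complex.exp (J h) * φ (θ * Real.exp (-h))) 0
      (Set.Ici 0) 0 :=
    (hasDerivWithinAt_const (0 : ℝ) _ (φ θ)).congr (fun h hh ↦ hconst ⟨h, hh⟩) (hconst 0)
  -- The identity is known only for `h ≥ 0`, so derivatives are compared from the right.
  have := (uniqueDiffOn_Ici (0 : ℝ) 0 Set.self_mem_Ici).eq_deriv _ hg.hasDerivWithinAt hz
  simp [hJ] at this
  linear_combination this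

/-- If `η(θ) φ(θ) = θ φ'(θ)` and `φ(0) = 1`, then `φ(θ) = lim exp (∫_0^T η(θ e^{-s}) ds)`. -/
lemma tendsto_exp_integral_exponent {η φ φ' : ℝ → ℂ} (hη : Continuous η)
    (hφ : ∀ θ, HasDerivAt φ (φ' θ) θ) (hφ0 : φ 0 = 1) (hne : ∀ θ, φ θ ≠ 0)
    (heq : ∀ θ : ℝ, θ * φ' θ = η θ * φ θ) (θ : ℝ) :
    Tendsto (fun T : ℝ≥0 ↦ Complex.exp (∫ s in (0 : ℝ)..T, η (θ * Real.exp (-s))))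
      atTop (𝓝 (φ θ)) := by
  have hc (θ : ℝ) : Continuous fun s ↦ η (θ * Real.exp (-s)) := by fun_prop
  set J : ℝ → ℂ := fun h ↦ ∫ s in (0 : ℝ)..h, η (θ * Real.exp (-s)) with hJ
  -- The equation makes this product constant in `h`; as `h → ∞` its second factor tends to `φ(0) =
  -- 1`.
  have hder (h : ℝ) : HasDerivAt (fun h ↦ Complex.exp (J h) * φ (θ * Real.exp (-h))) 0 h := by
    have hE : HasDerivAt (fun h : ℝ ↦ θ * Real.exp (-h)) (-(θ * Real.exp (-h))) h := by
      simpa using ((hasDerivAt_neg h).exp.const_mul θ)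
    have hφE := HasDerivAt.scomp h (hφ (θ * Real.exp (-h))) hE
    have hJd : HasDerivAt J (η (θ * Real.exp (-h))) h :=
      ((hc θ).integral_hasStrictDerivAt 0 h).hasDerivAt
    refine (hJd.cexp.mul hφE).congr_deriv ?_
    have := heq (θ * Real.exp (-h))
    simp only [neg_smul, Complex.real_smul, Function.comp_apply]
    rw [this]
    ring
  have hconst (h : ℝ) : Complex.exp (J h) * φ (θ * Real.exp (-h)) = φ θ := by
    have := is_const_of_deriv_eq_zero (fun x ↦ (hder x).differentiableAt)
      (fun x ↦ (hder x).deriv) h 0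
    simpa [hJ] using this
  have h0 : Tendsto (fun T : ℝ≥0 ↦ φ (θ * Real.exp (-(T : ℝ)))) atTop (𝓝 1) := by
    rw [← hφ0]
    refine ((hφ 0).continuousAt.tendsto).comp ?_
    have := (Real.tendsto_exp_neg_atTop_nhds_zero.comp
      (NNReal.tendsto_coe_atTop.2 tendsto_id)).const_mul θ
    simpa using this
  have h1 := (tendsto_const_nhds (x := φ θ)).div h0 one_ne_zero
  rw [div_one] at h1
  refine h1.congr fun T ↦ ?_
  rw [Pi.div_apply, div_eq_iff (hne _)]
  exact (hconst T).symm

end Selfdecomposable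

/-! ### Compound Poisson sums -/

section PoissonMarks

variable {E : Type*} [MeasurableSpace E]

/-- The law of a pair `(N, (xᵢ)ᵢ)` of independent variables, where `N` is Poisson with parameter
`1` and the marks `xᵢ` are i.i.d. with law `ρ`. -/
noncomputable def poissonMarks (ρ : Measure E) [IsProbabilityMeasure ρ] : Measure (ℕ × (ℕ → E)) :=
  (poissonMeasure 1).prod (Measure.infinitePi fun _ : ℕ ↦ ρ)

instance (ρ : Measure E) [IsProbabilityMeasure ρ] : IsProbabilityMeasure (poissonMarks ρ) := by
  unfold poissonMarks; infer_instance

/-- The sum of `f` over the first `N` marks. -/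
noncomputable def pointSum (f : E → ℝ) (b : ℕ × (ℕ → E)) : ℝ :=
  ∑ i ∈ Finset.range b.1, f (b.2 i)

lemma measurable_pointSum_prod {A : Type*} [MeasurableSpace A] {f : A → E → ℝ}
    (hf : Measurable (Function.uncurry f)) :
    Measurable fun z : A × (ℕ × (ℕ → E)) ↦ pointSum (f z.1) z.2 := by
  have h : Measurable fun y : ℕ × (A × (ℕ → E)) ↦ ∑ i ∈ Finset.range y.1, f y.2.1 (y.2.2 i) := by
    refine measurable_from_prod_countable_right fun n ↦ ?_
    change Measurable fun y : A × (ℕ → E) ↦ ∑ i ∈ Finset.range n, f y.1 (y.2 i)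
    refine Finset.measurable_fun_sum _ fun i _ ↦ ?_
    exact hf.comp (measurable_fst.prodMk ((measurable_pi_apply i).comp measurable_snd))
  have hg : Measurable fun z : A × (ℕ × (ℕ → E)) ↦ (z.2.1, (z.1, z.2.2)) := by fun_prop
  exact h.comp hg

lemma measurable_pointSum {f : E → ℝ} (hf : Measurable f) : Measurable (pointSum f) := by
  have := measurable_pointSum_prod (A := Unit) (f := fun _ ↦ f) (hf.comp measurable_snd)
  exact this.comp (measurable_const.prodMk measurable_id : Measurable fun b ↦ ((), b))

/-- Conditioning on the number of marks gives `e^{-1} ∑ z^n / n! = e^{z - 1}`, with `z` the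
characteristic function of `f` under `ρ`. -/
lemma charFun_map_pointSum (ρ : Measure E) [IsProbabilityMeasure ρ] {f : E → ℝ}
    (hf : Measurable f) (θ : ℝ) :
    charFun ((poissonMarks ρ).map (pointSum f)) θ =
      Complex.exp (∫ x, (Complex.exp (θ * f x * Complex.I) - 1) ∂ρ) := by
  have hm := measurable_pointSum hf
  have hint : Integrable (fun b ↦ Complex.exp (θ * pointSum f b * Complex.I)) (poissonMarks ρ) := by
    refine .of_bound (by fun_prop) 1 (ae_of_all _ fun b ↦ ?_)
    rw [← Complex.ofReal_mul, Complex.norm_exp_ofReal_mul_I]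
  have hint2 : Integrable (fun x ↦ Complex.exp (θ * f x * Complex.I)) ρ := by
    refine .of_bound (by fun_prop) 1 (ae_of_all _ fun b ↦ ?_)
    rw [← Complex.ofReal_mul, Complex.norm_exp_ofReal_mul_I]
  rw [charFun_map_real hm.aemeasurable]
  unfold poissonMarks at hint ⊢
  rw [integral_prod _ hint]
  set z := ∫ x, Complex.exp (θ * f x * Complex.I) ∂ρ with hz
  have hinner (n : ℕ) : ∫ y, Complex.exp (θ * pointSum f (n, y) * Complex.I)
      ∂(Measure.infinitePi fun _ : ℕ ↦ ρ) = z ^ n := by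
    have hfi (i : ℕ) : Measurable fun y : ℕ → E ↦ f (y i) := hf.comp (measurable_pi_apply i)
    have hind := iIndepFun_infinitePi (P := fun _ : ℕ ↦ ρ) (X := fun _ ↦ f) fun _ ↦ hf
    have h := congrFun (iIndepFun.charFun_map_fun_finsetSum_eq_prod (s := Finset.range n)
      (P := Measure.infinitePi fun _ : ℕ ↦ ρ) (X := fun i y ↦ f (y i))
      (fun j _ ↦ (hfi j).aemeasurable)
      (iIndepFun.precomp (g := fun i : Finset.range n ↦ (i : ℕ)) Subtype.val_injective hind)) θ
    rw [charFun_map_real (Finset.measurable_fun_sum _ fun i _ ↦ hfi i).aemeasurable,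
      Finset.prod_apply] at h
    have hk (i : ℕ) : charFun ((Measure.infinitePi fun _ : ℕ ↦ ρ).map fun y ↦ f (y i)) θ = z := by
      have : (Measure.infinitePi fun _ : ℕ ↦ ρ).map (fun y ↦ f (y i)) = ρ.map f := by
        conv_rhs => rw [← Measure.infinitePi_map_eval (fun _ : ℕ ↦ ρ) i]
        rw [Measure.map_map hf (measurable_pi_apply i)]
        rfl
      rw [this, charFun_map_real hf.aemeasurable]
    simp only [hk, Finset.prod_const, Finset.card_range] at h
    exact h
  simp_rw [hinner]
  rw [integral_poissonMeasure, integral_sub hint2 (integrable_const _), ← hz, integral_const,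
    probReal_univ, one_smul, sub_eq_add_neg, Complex.exp_add, mul_comm]
  have hexp : Complex.exp z = ∑' n : ℕ, z ^ n / (n.factorial : ℂ) := by
    rw [Complex.exp_eq_exp_ℂ, NormedSpace.exp_eq_tsum_div]
  rw [hexp, ← tsum_mul_left]
  refine tsum_congr fun n ↦ ?_
  rw [Complex.real_smul]
  push_cast
  rw [one_pow]
  ring

end PoissonMarks

/-! ### Joint laws of increments -/

section Increments

variable {Ω : Type*} [MeasurableSpace Ω] {P : Measure Ω}

/-- The increments of `Z` over consecutive intervals are jointly distributed as independent
variables, the increment over `(s, t]` having characteristic function `exp (G s t θ)`. -/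
def HasIncrementExponent (Z : ℝ≥0 → Ω → ℝ) (P : Measure Ω) (G : ℝ≥0 → ℝ≥0 → ℝ → ℂ) : Prop :=
  ∀ (s : ℕ → ℝ≥0), Monotone s → ∀ (m : ℕ) (θ : ℕ → ℝ),
    charFun (P.map fun ω ↦ ∑ j ∈ Finset.range m, θ j * (Z (s (j + 1)) ω - Z (s j) ω)) 1 =
      Complex.exp (∑ j ∈ Finset.range m, G (s j) (s (j + 1)) (θ j))

variable {Z : ℝ≥0 → Ω → ℝ} {G : ℝ≥0 → ℝ≥0 → ℝ → ℂ}

lemma HasIncrementExponent.charFun_sub (h : HasIncrementExponent Z P G) {s t : ℝ≥0} (hst : s ≤ t)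
    (hZ : ∀ t, Measurable (Z t)) (θ : ℝ) :
    charFun (P.map fun ω ↦ Z t ω - Z s ω) θ = Complex.exp (G s t θ) := by
  have := h (fun j ↦ if j = 0 then s else t) (fun i j hij ↦ by
    by_cases hi : i = 0 <;> by_cases hj : j = 0 <;> simp [hi, hj, hst]
    omega) 1 (fun _ ↦ θ)
  simp only [Finset.range_one, Finset.sum_singleton, zero_add, one_ne_zero, if_false, if_true]
    at this
  rw [← this, charFun_map_mul_comp (by fun_prop), mul_one]

lemma HasIncrementExponent.hasIndepIncrements [IsProbabilityMeasure P]
    (h : HasIncrementExponent Z P G) (hZ : ∀ t, Measurable (Z t)) : HasIndepIncrements Z P := by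
  intro n t ht
  rw [iIndepFun_iff_charFun_pi fun i ↦ by fun_prop]
  intro τ
  -- The finite list of times is frozen at its last entry to form a monotone sequence on `ℕ`.
  set s : ℕ → ℝ≥0 := fun k ↦ t ⟨min n k, by omega⟩ with hs
  have hsm : Monotone s := fun a b hab ↦ ht (by
    simp only [Fin.mk_le_mk]; omega)
  set c : ℕ → ℝ := fun k ↦ if hk : k < n then τ ⟨k, hk⟩ else 0 with hc
  have key := h s hsm n c
  have e1 (i : Fin n) : s (i + 1) = t i.succ := by
    simp only [hs]; congr 1; ext; simp
  have e2 (i : Fin n) : s i = t i.castSucc := by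
    simp only [hs]; congr 1; ext; simp
  have e3 (i : Fin n) : c i = τ i := by simp [hc]
  have hsum (ω : Ω) : ∑ j ∈ Finset.range n, c j * (Z (s (j + 1)) ω - Z (s j) ω) =
      ∑ i : Fin n, τ i * (Z (t i.succ) ω - Z (t i.castSucc) ω) := by
    rw [Finset.sum_range]
    exact Finset.sum_congr rfl fun i _ ↦ by rw [e1, e2, e3]
  rw [Finset.sum_range, Complex.exp_sum] at key
  simp_rw [hsum, e1, e2, e3] at key
  have hR : ∀ i : Fin n, charFun (P.map fun ω ↦ Z (t i.succ) ω - Z (t i.castSucc) ω) (τ i) =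
      Complex.exp (G (t i.castSucc) (t i.succ) (τ i)) := fun i ↦
    h.charFun_sub (ht (Fin.castSucc_le_succ i)) hZ _
  simp_rw [hR]
  rw [← key, charFun_map_real (by fun_prop), charFun_apply, integral_map (by fun_prop)
    (by fun_prop)]
  refine integral_congr_ae (ae_of_all _ fun ω ↦ ?_)
  simp only [PiLp.inner_apply, RCLike.inner_apply, conj_trivial, Complex.ofReal_one, one_mul]

lemma HasIncrementExponent.add_linear (h : HasIncrementExponent Z P G)
    (hZ : ∀ t, Measurable (Z t)) (c : ℝ) :
    HasIncrementExponent (fun t ω ↦ c * t + Z t ω) P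
      (fun s t θ ↦ Complex.I * θ * c * ((t : ℝ) - (s : ℝ) : ℝ) + G s t θ) := by
  intro s hs m θ
  have e (ω : Ω) : ∑ j ∈ Finset.range m, θ j * (c * s (j + 1) + Z (s (j + 1)) ω -
      (c * s j + Z (s j) ω)) = ∑ j ∈ Finset.range m, θ j * (Z (s (j + 1)) ω - Z (s j) ω) +
      ∑ j ∈ Finset.range m, θ j * c * ((s (j + 1) : ℝ) - s j) := by
    rw [← Finset.sum_add_distrib]
    exact Finset.sum_congr rfl fun j _ ↦ by ring
  simp_rw [e]
  have key := h s hs m θ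
  rw [charFun_map_real (by fun_prop)] at key ⊢
  rw [Finset.sum_add_distrib, add_comm, Complex.exp_add, ← key, mul_comm, ← integral_const_mul]
  refine integral_congr_ae (ae_of_all _ fun ω ↦ ?_)
  simp only
  rw [← Complex.exp_add]
  congr 1
  push_cast
  rw [mul_add, add_mul, add_comm, one_mul, one_mul]
  congr 1
  rw [Finset.sum_mul]
  exact Finset.sum_congr rfl fun j _ ↦ by ring

end Increments

/-! ### Moments from the characteristic function -/

section SecondMoment

/-- A quadratic bound on `1 - φ` near `0` gives a finite second moment and mean zero. -/
lemma moments_of_norm_charFun_sub_one_le {μ : Measure ℝ} [IsProbabilityMeasure μ] {K : ℝ}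
    (hK : ∀ᶠ θ : ℝ in 𝓝 0, ‖charFun μ θ - 1‖ ≤ K * θ ^ 2) :
    MemLp id 2 μ ∧ ∫ x, x ^ 2 ∂μ ≤ 2 * K ∧ ∫ x, x ∂μ = 0 := by
  have hint (h : ℝ) : Integrable (fun x : ℝ ↦ Complex.exp (h * x * Complex.I)) μ := by
    refine .of_bound (by fun_prop) 1 (ae_of_all _ fun b ↦ ?_)
    rw [← Complex.ofReal_mul, Complex.norm_exp_ofReal_mul_I]
  have hcos (h : ℝ) : ∫ x, (1 - Real.cos (h * x)) ∂μ = (1 - charFun μ h).re := by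
    rw [charFun_apply_real, Complex.sub_re, Complex.one_re]
    have h1 := integral_re (hint h)
    simp only [RCLike.re_eq_complex_re] at h1
    have h2 (x : ℝ) : (Complex.exp (h * x * Complex.I)).re = Real.cos (h * x) := by
      rw [← Complex.ofReal_mul, Complex.exp_ofReal_mul_I_re]
    rw [← h1, integral_sub (integrable_const _) (by
      have := (hint h).re
      simp only [RCLike.re_eq_complex_re, h2] at this
      exact this)]
    simp [h2]
  set u : ℕ → ℝ := fun n ↦ 1 / ((n : ℝ) + 1) with hu
  have hu0 : Tendsto u atTop (𝓝 0) := tendsto_one_div_add_atTop_nhds_zero_nat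
  have hupos (n : ℕ) : 0 < u n := by positivity
  have hu1 : Tendsto u atTop (𝓝[≠] 0) :=
    tendsto_nhdsWithin_iff.2 ⟨hu0, Eventually.of_forall fun n ↦ (hupos n).ne'⟩
  have hlim (x : ℝ) : Tendsto (fun n ↦ ENNReal.ofReal (((u n)⁻¹ * Real.sin (u n * x)) ^ 2)) atTop
      (𝓝 (ENNReal.ofReal (x ^ 2))) := by
    have hd : HasDerivAt (fun h : ℝ ↦ Real.sin (h * x)) x 0 := by
      have := ((hasDerivAt_id (0 : ℝ)).mul_const x).sin
      simpa using this
    have := (hasDerivAt_iff_tendsto_slope_zero.1 hd).comp hu1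
    simp only [Function.comp_def, zero_add, zero_mul, Real.sin_zero, sub_zero, smul_eq_mul] at this
    exact (ENNReal.continuous_ofReal.tendsto _).comp (this.pow 2)
  -- Since `1 - cos(2ux) = 2 sin²(ux)`, the hypothesis at `2u` bounds `𝔼 sin²(ux) / u²` by `K (2u)²
  -- / (2u²) = 2K`. Fatou's lemma then bounds the second moment.
  have hbound : ∀ᶠ n in atTop, ∫⁻ x, ENNReal.ofReal (((u n)⁻¹ * Real.sin (u n * x)) ^ 2) ∂μ ≤
      ENNReal.ofReal (2 * K) := by
    have h2 : Tendsto (fun n ↦ 2 * u n) atTop (𝓝 0) := by simpa using hu0.const_mul 2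
    filter_upwards [h2.eventually hK] with n hn
    have e (x : ℝ) : ((u n)⁻¹ * Real.sin (u n * x)) ^ 2 =
        ((u n) ^ 2)⁻¹ / 2 * (1 - Real.cos (2 * u n * x)) := by
      rw [mul_assoc 2, Real.cos_two_mul, mul_pow, Real.sin_sq]
      ring
    rw [← ofReal_integral_eq_lintegral_ofReal]
    · refine ENNReal.ofReal_le_ofReal ?_
      simp_rw [e]
      rw [integral_const_mul, hcos]
      have h3 : (1 - charFun μ (2 * u n)).re ≤ K * (2 * u n) ^ 2 :=
        (Complex.re_le_norm _).trans (by rwa [norm_sub_rev])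
      have := hupos n
      calc _ ≤ ((u n) ^ 2)⁻¹ / 2 * (K * (2 * u n) ^ 2) := by gcongr
        _ = 2 * K := by field_simp
    · refine .of_bound (by fun_prop) (((u n)⁻¹) ^ 2) (ae_of_all _ fun x ↦ ?_)
      rw [Real.norm_of_nonneg (sq_nonneg _), mul_pow]
      exact mul_le_of_le_one_right (sq_nonneg _) (Real.sin_sq_le_one _)
    · exact ae_of_all _ fun x ↦ sq_nonneg _
  have hfatou : ∫⁻ x, ENNReal.ofReal (x ^ 2) ∂μ ≤ ENNReal.ofReal (2 * K) := by
    calc ∫⁻ x, ENNReal.ofReal (x ^ 2) ∂μ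
        = ∫⁻ x, liminf (fun n ↦ ENNReal.ofReal (((u n)⁻¹ * Real.sin (u n * x)) ^ 2)) atTop ∂μ :=
          lintegral_congr fun x ↦ (hlim x).liminf_eq.symm
      _ ≤ liminf (fun n ↦ ∫⁻ x, ENNReal.ofReal (((u n)⁻¹ * Real.sin (u n * x)) ^ 2) ∂μ) atTop :=
          lintegral_liminf_le fun n ↦ by fun_prop
      _ ≤ ENNReal.ofReal (2 * K) :=
          liminf_le_of_le (by isBoundedDefault) fun b hb ↦ by
            obtain ⟨n, h1, h2⟩ := (hb.and hbound).exists
            exact h1.trans h2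
  have hsq : Integrable (fun x : ℝ ↦ x ^ 2) μ := by
    refine ⟨by fun_prop, ?_⟩
    rw [hasFiniteIntegral_iff_ofReal (ae_of_all _ fun x ↦ sq_nonneg x)]
    exact hfatou.trans_lt ENNReal.ofReal_lt_top
  have hK0 : 0 ≤ K := by
    obtain ⟨n, hn⟩ := (hu0.eventually hK).exists
    have := (norm_nonneg _).trans hn
    exact nonneg_of_mul_nonneg_left this (by have := hupos n; positivity)
  have hmem : MemLp id 2 μ := (memLp_two_iff_integrable_sq (by fun_prop)).2 hsq
  refine ⟨hmem, ?_, ?_⟩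
  · rw [← ENNReal.ofReal_le_ofReal_iff (by positivity), ofReal_integral_eq_lintegral_ofReal hsq
      (ae_of_all _ fun x ↦ sq_nonneg x)]
    exact hfatou
  · have hid : Integrable (fun x : ℝ ↦ x) μ := hmem.integrable one_le_two
    have h1 : Tendsto (fun n ↦ ∫ x, (((u n)⁻¹ : ℝ) : ℂ) *
        (Complex.exp (u n * x * Complex.I) - 1) ∂μ) atTop (𝓝 (∫ x, (x : ℂ) * Complex.I ∂μ)) := by
      refine tendsto_integral_of_dominated_convergence (fun x ↦ |x|) (fun n ↦ by fun_prop)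
        hid.abs (fun n ↦ ae_of_all _ fun x ↦ ?_) (ae_of_all _ fun x ↦ ?_)
      · rw [norm_mul, Complex.norm_real, norm_inv, Real.norm_of_nonneg (hupos n).le,
          inv_mul_le_iff₀ (hupos n)]
        have := Real.norm_exp_I_mul_ofReal_sub_one_le (x := u n * x)
        rw [mul_comm Complex.I, Real.norm_eq_abs, abs_mul, abs_of_pos (hupos n)] at this
        push_cast at this
        exact this
      · have hd : HasDerivAt (fun h : ℝ ↦ Complex.exp (h * x * Complex.I)) (x * Complex.I) 0 := by
          have := (((hasDerivAt_id (0 : ℝ)).ofReal_comp.mul_const (x : ℂ)).mul_const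
            Complex.I).cexp
          simpa using this
        have := (hasDerivAt_iff_tendsto_slope_zero.1 hd).comp hu1
        simpa [Function.comp_def] using this
    -- The difference quotient of the characteristic function at `0` is at most `K u` in norm, but
    -- it also tends to `i` times the mean.
    have h2 : Tendsto (fun n ↦ ∫ x, (((u n)⁻¹ : ℝ) : ℂ) *
        (Complex.exp (u n * x * Complex.I) - 1) ∂μ) atTop (𝓝 0) := by
      have h3 : Tendsto (fun n ↦ K * u n) atTop (𝓝 0) := by simpa using hu0.const_mul K
      refine squeeze_zero_norm' ?_ h3
      filter_upwards [hu0.eventually hK] with n hn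
      rw [integral_const_mul, integral_sub (hint _) (integrable_const _), ← charFun_apply_real]
      simp only [integral_const, probReal_univ, one_smul]
      have := hupos n
      rw [norm_mul, Complex.norm_real, norm_inv, Real.norm_of_nonneg this.le, inv_mul_le_iff₀ this]
      calc _ ≤ _ := hn
        _ = _ := by ring
    have h4 := tendsto_nhds_unique h1 h2
    rw [integral_mul_const, mul_eq_zero, or_iff_left Complex.I_ne_zero,
      integral_complex_ofReal] at h4
    exact_mod_cast h4

end SecondMoment

/-! ### Independent compensated blocks of jumps -/

section Blocks

/-- The length of `(n, n + 1] ∩ (0, t]`. -/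
noncomputable def unitOverlap (n : ℕ) (t : ℝ) : ℝ := max (min (t - n) 1) 0

lemma unitOverlap_le_one (n : ℕ) (t : ℝ) : unitOverlap n t ≤ 1 :=
  max_le (min_le_right _ _) zero_le_one

lemma unitOverlap_mono (n : ℕ) : Monotone (unitOverlap n) := fun s t h ↦ by
  unfold unitOverlap; gcongr

lemma continuous_unitOverlap (n : ℕ) : Continuous (unitOverlap n) := by
  unfold unitOverlap; fun_prop

lemma unitOverlap_eq_zero {n : ℕ} {t : ℝ} (h : t ≤ n) : unitOverlap n t = 0 := by
  rw [unitOverlap, max_eq_right]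
  exact (min_le_left _ _).trans (by linarith)

lemma sum_unitOverlap {N : ℕ} {t : ℝ} (h0 : 0 ≤ t) (h : t ≤ N) :
    ∑ n ∈ Finset.range N, unitOverlap n t = t := by
  have key : ∀ N : ℕ, ∑ n ∈ Finset.range N, unitOverlap n t = min t N := by
    intro N
    induction N with
    | zero => simp [h0]
    | succ N ih =>
      rw [Finset.sum_range_succ, ih, unitOverlap]
      push_cast
      rcases le_total t N with h1 | h1
      · rw [min_eq_left h1, min_eq_left (by linarith : t - N ≤ 1), max_eq_right (by linarith),
          min_eq_left (by linarith), add_zero]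
      · rw [min_eq_right h1, max_eq_left (le_min (by linarith) zero_le_one)]
        rcases le_total t (N + 1) with h2 | h2
        · rw [min_eq_left (by linarith : t - N ≤ 1), min_eq_left h2]; ring
        · rw [min_eq_right (by linarith : 1 ≤ t - N), min_eq_right h2]
  rw [key, min_eq_left h]

lemma integral_indicator_unit (n : ℕ) {s t : ℝ} (hst : s ≤ t) :
    ∫ u in Set.Ioc (0 : ℝ) 1, (if s < n + u ∧ n + u ≤ t then (1 : ℂ) else 0) =
      ((unitOverlap n t - unitOverlap n s : ℝ) : ℂ) := by
  have e : (fun u : ℝ ↦ if s < n + u ∧ n + u ≤ t then (1 : ℂ) else 0) =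
      (Set.Ioc (s - n) (t - n)).indicator fun _ ↦ 1 := by
    ext u
    simp only [Set.indicator, Set.mem_Ioc]
    congr 1
    apply propext
    constructor <;> rintro ⟨h1, h2⟩ <;> constructor <;> linarith
  rw [e, integral_indicator_const _ measurableSet_Ioc, measureReal_restrict_apply measurableSet_Ioc,
    Set.Ioc_inter_Ioc, Real.volume_real_Ioc, Complex.real_smul, mul_one]
  congr 1
  simp only [unitOverlap, max_def, min_def]
  split_ifs <;> linarith

/-- The law of a mark: a uniform position in `(0, 1]` and an independent standard exponential
size. -/
noncomputable def markLaw : Measure (ℝ × ℝ) :=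
  (volume.restrict (Set.Ioc (0 : ℝ) 1)).prod (expMeasure 1)

instance : IsProbabilityMeasure (expMeasure 1) := isProbabilityMeasure_expMeasure one_pos

instance : IsProbabilityMeasure (volume.restrict (Set.Ioc (0 : ℝ) 1)) :=
  ⟨by simp⟩

instance : IsProbabilityMeasure markLaw := by unfold markLaw; infer_instance

lemma charFun_expMeasure_one (τ : ℝ) : charFun (expMeasure 1) τ = 1 / (1 - Complex.I * τ) := by
  have hm : Measurable fun x ↦ gammaPDF 1 1 x :=
    (measurable_gammaPDFReal 1 1).ennreal_ofReal
  rw [charFun_apply_real, expMeasure, gammaMeasure,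
    integral_withDensity_eq_integral_toReal_smul hm (ae_of_all _ fun x ↦ by simp [gammaPDF])]
  have h1 : ∀ x : ℝ, x ∉ Set.Ici 0 → (gammaPDF 1 1 x).toReal •
      Complex.exp (τ * x * Complex.I) = 0 := by
    intro x hx
    rw [gammaPDF_of_neg (by simpa using hx)]
    simp
  rw [← setIntegral_eq_integral_of_forall_compl_eq_zero h1, integral_Ici_eq_integral_Ioi]
  have e : ∀ x ∈ Set.Ioi (0 : ℝ), (gammaPDF 1 1 x).toReal •
      Complex.exp (τ * x * Complex.I) = Complex.exp ((-1 + Complex.I * τ) * x) := by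
    intro x (hx : 0 < x)
    rw [gammaPDF_of_nonneg hx.le, ENNReal.toReal_ofReal (by simp; positivity), Complex.real_smul]
    simp only [Real.one_rpow, Real.Gamma_one, div_one, sub_self, Real.rpow_zero, one_mul]
    push_cast
    rw [← Complex.exp_add]
    congr 1
    ring
  have hre : (-1 + Complex.I * τ).re < 0 := by simp
  rw [setIntegral_congr_fun measurableSet_Ioi e, integral_exp_mul_complex_Ioi hre]
  have hne : (1 : ℂ) - Complex.I * τ ≠ 0 := by
    have := ofReal_add_I_mul_ne_zero one_pos (-τ)
    push_cast at this
    simpa [sub_eq_add_neg] using this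
  have hne' : -1 + Complex.I * τ ≠ 0 := by
    rw [show -1 + Complex.I * (τ : ℂ) = -(1 - Complex.I * τ) by ring]
    exact neg_ne_zero.2 hne
  simp only [Complex.ofReal_zero, mul_zero, Complex.exp_zero]
  field_simp
  ring

/-- The contribution at time `t` of a mark `(u, x)`: a jump `-x / (α + k)` at time `n + u`,
for `p = (k, n)`. -/
noncomputable def markJump (α : ℝ) (p : ℕ × ℕ) (t : ℝ) (e : ℝ × ℝ) : ℝ :=
  if p.2 + e.1 ≤ t then -(e.2 / (α + p.1)) else 0

lemma measurable_markJump_uncurry (α : ℝ) (p : ℕ × ℕ) :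
    Measurable fun z : ℝ × (ℝ × ℝ) ↦ markJump α p z.1 z.2 := by
  unfold markJump
  exact Measurable.ite (measurableSet_le (by fun_prop) (by fun_prop)) (by fun_prop)
    measurable_const

lemma measurable_markJump (α : ℝ) (p : ℕ × ℕ) (t : ℝ) : Measurable (markJump α p t) :=
  (measurable_markJump_uncurry α p).comp (measurable_const.prodMk measurable_id)

/-- A weighted sum of increments of the contribution of a mark. -/
noncomputable def markIncrement (α : ℝ) (p : ℕ × ℕ) (s θ : ℕ → ℝ) (m : ℕ) (e : ℝ × ℝ) : ℝ :=
  ∑ j ∈ Finset.range m, θ j * (markJump α p (s (j + 1)) e - markJump α p (s j) e)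

lemma measurable_markIncrement (α : ℝ) (p : ℕ × ℕ) (s θ : ℕ → ℝ) (m : ℕ) :
    Measurable (markIncrement α p s θ m) := by
  have := measurable_markJump α p
  unfold markIncrement
  fun_prop

/-- A mark jumps only once, so at most one of the disjoint intervals `(s j, s (j + 1)]` contains its
time. The exponential of the sum therefore splits additively after subtracting `1`. -/
lemma exp_markIncrement_sub_one (α : ℝ) (p : ℕ × ℕ) {s : ℕ → ℝ} (hs : Monotone s) (θ : ℕ → ℝ)
    (m : ℕ) (e : ℝ × ℝ) :
    Complex.exp (markIncrement α p s θ m e * Complex.I) - 1 = ∑ j ∈ Finset.range m,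
      (if s j < p.2 + e.1 ∧ p.2 + e.1 ≤ s (j + 1) then (1 : ℂ) else 0) *
        (Complex.exp ((-(θ j / (α + p.1)) : ℝ) * e.2 * Complex.I) - 1) := by
  have hlate : ∀ m, s m < p.2 + e.1 → markIncrement α p s θ m e = 0 := fun m hm ↦ by
    refine Finset.sum_eq_zero fun j hj ↦ ?_
    rw [Finset.mem_range] at hj
    have h1 : s j < p.2 + e.1 := (hs hj.le).trans_lt hm
    have h2 : s (j + 1) < p.2 + e.1 := (hs hj).trans_lt hm
    simp [markJump, h1.not_ge, h2.not_ge]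
  induction m with
  | zero => simp [markIncrement]
  | succ m ih =>
    rw [Finset.sum_range_succ, ← ih]
    have hsucc : markIncrement α p s θ (m + 1) e = markIncrement α p s θ m e +
        θ m * (markJump α p (s (m + 1)) e - markJump α p (s m) e) := by
      rw [markIncrement, Finset.sum_range_succ]; rfl
    rw [hsucc]
    by_cases h1 : s m < p.2 + e.1
    · rw [hlate m h1]
      by_cases h2 : p.2 + e.1 ≤ s (m + 1)
      · simp only [markJump, h1, h1.not_ge, h2, and_self, if_true, if_false]
        simp only [Complex.ofReal_zero, zero_mul, Complex.exp_zero, sub_self, zero_add, one_mul]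
        congr 2
        push_cast
        ring
      · simp [markJump, h1.not_ge, h2]
    · have h2 : p.2 + e.1 ≤ s m := not_lt.1 h1
      have h3 : p.2 + e.1 ≤ s (m + 1) := h2.trans (hs m.le_succ)
      simp [markJump, h1, h2, h3]

lemma integral_exp_markIncrement_sub_one (α : ℝ) (p : ℕ × ℕ) {s : ℕ → ℝ}
    (hs : Monotone s) (θ : ℕ → ℝ) (m : ℕ) :
    ∫ e, (Complex.exp (markIncrement α p s θ m e * Complex.I) - 1) ∂markLaw =
      ∑ j ∈ Finset.range m, ((unitOverlap p.2 (s (j + 1)) - unitOverlap p.2 (s j) : ℝ) : ℂ) *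
        (1 / (1 + Complex.I * θ j / (α + p.1 : ℝ)) - 1) := by
  have hexp (τ : ℝ) : Integrable (fun x : ℝ ↦ Complex.exp (τ * x * Complex.I)) (expMeasure 1) := by
    refine .of_bound (by fun_prop) 1 (ae_of_all _ fun b ↦ ?_)
    rw [← Complex.ofReal_mul, Complex.norm_exp_ofReal_mul_I]
  have hind (a b : ℝ) : Integrable (fun u : ℝ ↦ if a < p.2 + u ∧ p.2 + u ≤ b then (1 : ℂ) else 0)
      (volume.restrict (Set.Ioc (0 : ℝ) 1)) := by
    refine .of_bound (Measurable.aestronglyMeasurable ?_) 1 (ae_of_all _ fun u ↦ ?_)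
    · have h1 : MeasurableSet {u : ℝ | a < p.2 + u} := measurableSet_lt (by fun_prop) (by fun_prop)
      have h2 : MeasurableSet {u : ℝ | p.2 + u ≤ b} := measurableSet_le (by fun_prop) (by fun_prop)
      exact Measurable.ite (h1.inter h2) measurable_const measurable_const
    · split_ifs <;> simp
  simp_rw [exp_markIncrement_sub_one α p hs]
  rw [markLaw, integral_finsetSum _ fun j _ ↦ by
    exact (hind _ _).mul_prod ((hexp _).sub (integrable_const _))]
  refine Finset.sum_congr rfl fun j _ ↦ ?_
  rw [integral_prod_mul (fun u : ℝ ↦ if s j < p.2 + u ∧ p.2 + u ≤ s (j + 1) then (1 : ℂ) else 0)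
    (fun x : ℝ ↦ Complex.exp ((-(θ j / (α + p.1)) : ℝ) * x * Complex.I) - 1),
    integral_indicator_unit _ (hs j.le_succ), integral_sub (hexp _) (integrable_const _),
    ← charFun_apply_real, charFun_expMeasure_one]
  simp only [integral_const, probReal_univ, one_smul]
  congr 3
  push_cast
  ring

/-- The sample space: independent Poisson families of marks indexed by `(k, n)`. -/
abbrev MarkSpace : Type := ℕ × ℕ → ℕ × (ℕ → ℝ × ℝ)

/-- The law of the independent Poisson families of marks. -/
noncomputable def markMeasure : Measure MarkSpace :=
  Measure.infinitePi fun _ : ℕ × ℕ ↦ poissonMarks markLaw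

instance : IsProbabilityMeasure markMeasure := by unfold markMeasure; infer_instance

/-- The compensated sum of the jumps of the `(k, n)`-th family of marks up to time `t`. -/
noncomputable def blockJumps (α : ℝ) (p : ℕ × ℕ) (t : ℝ≥0) (ω : MarkSpace) : ℝ :=
  pointSum (markJump α p t) (ω p) + unitOverlap p.2 t / (α + p.1)

lemma measurable_blockJumps_uncurry (α : ℝ) (p : ℕ × ℕ) :
    Measurable fun z : ℝ≥0 × MarkSpace ↦ blockJumps α p z.1 z.2 := by
  have h1 := measurable_pointSum_prod (A := ℝ) (f := fun t e ↦ markJump α p t e)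
    (measurable_markJump_uncurry α p)
  have h2 : Measurable fun z : ℝ≥0 × MarkSpace ↦ ((z.1 : ℝ), z.2 p) := by fun_prop
  have h3 : Measurable fun z : ℝ≥0 × MarkSpace ↦ unitOverlap p.2 z.1 / (α + p.1) :=
    ((continuous_unitOverlap p.2).measurable.comp (by fun_prop)).div_const _
  exact (h1.comp h2).add h3

lemma measurable_blockJumps (α : ℝ) (p : ℕ × ℕ) (t : ℝ≥0) : Measurable (blockJumps α p t) :=
  (measurable_blockJumps_uncurry α p).comp (measurable_const.prodMk measurable_id)

/-- The sum of the compensated jumps over a finite set of families, normalized to start at `0`. -/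
noncomputable def finiteJumps (α : ℝ) (C : Finset (ℕ × ℕ)) (t : ℝ≥0) (ω : MarkSpace) : ℝ :=
  ∑ p ∈ C, (blockJumps α p t ω - blockJumps α p 0 ω)

lemma measurable_finiteJumps_uncurry (α : ℝ) (C : Finset (ℕ × ℕ)) :
    Measurable fun z : ℝ≥0 × MarkSpace ↦ finiteJumps α C z.1 z.2 :=
  Finset.measurable_fun_sum _ fun p _ ↦ (measurable_blockJumps_uncurry α p).sub
    ((measurable_blockJumps α p 0).comp measurable_snd)

lemma measurable_finiteJumps (α : ℝ) (C : Finset (ℕ × ℕ)) (t : ℝ≥0) :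
    Measurable (finiteJumps α C t) :=
  Finset.measurable_fun_sum _ fun p _ ↦ (measurable_blockJumps α p t).sub
    (measurable_blockJumps α p 0)

/-- With `β = α + p.1`, the jumps contribute `1/(1 + iθ/β) - 1 = -iθ/(β + iθ)` per unit time and the
compensator `iθ/β`; their sum is `levyTerm`. -/
lemma charFun_blockJumps_increments {α : ℝ} (hα : 0 < α) (p : ℕ × ℕ) {s : ℕ → ℝ≥0}
    (hs : Monotone s) (m : ℕ) (θ : ℕ → ℝ) :
    charFun (markMeasure.map fun ω ↦ ∑ j ∈ Finset.range m, θ j *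
      (blockJumps α p (s (j + 1)) ω - blockJumps α p (s j) ω)) 1 =
      Complex.exp (∑ j ∈ Finset.range m, ((unitOverlap p.2 (s (j + 1)) - unitOverlap p.2 (s j) : ℝ)
        : ℂ) * levyTerm (α + p.1) (θ j)) := by
  have hβ : 0 < α + p.1 := by positivity
  have hs' : Monotone fun j ↦ (s j : ℝ) := fun i j h ↦ by exact_mod_cast hs h
  set f := markIncrement α p (fun j ↦ (s j : ℝ)) θ m with hf
  have hfm : Measurable f := measurable_markIncrement _ _ _ _ _
  set c : ℝ := ∑ j ∈ Finset.range m, θ j *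
    ((unitOverlap p.2 (s (j + 1)) - unitOverlap p.2 (s j)) / (α + p.1)) with hc
  have e (ω : MarkSpace) : ∑ j ∈ Finset.range m, θ j *
      (blockJumps α p (s (j + 1)) ω - blockJumps α p (s j) ω) = pointSum f (ω p) + c := by
    simp only [pointSum, hf, markIncrement, blockJumps]
    rw [Finset.sum_comm, hc, ← Finset.sum_add_distrib]
    refine Finset.sum_congr rfl fun j _ ↦ ?_
    rw [← Finset.mul_sum, Finset.sum_sub_distrib]
    ring
  have hpm : Measurable fun ω : MarkSpace ↦ pointSum f (ω p) :=
    (measurable_pointSum hfm).comp (measurable_pi_apply p)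
  have hmap : markMeasure.map (fun ω ↦ pointSum f (ω p)) =
      (poissonMarks markLaw).map (pointSum f) := by
    conv_rhs => rw [← Measure.infinitePi_map_eval (fun _ : ℕ × ℕ ↦ poissonMarks markLaw) p]
    rw [Measure.map_map (measurable_pointSum hfm) (measurable_pi_apply p)]
    rfl
  have h1 := charFun_map_pointSum markLaw hfm 1
  simp only [Complex.ofReal_one, one_mul] at h1
  rw [hf, integral_exp_markIncrement_sub_one α p hs', ← hf, ← hmap] at h1
  simp_rw [e]
  rw [charFun_map_real hpm.aemeasurable] at h1
  rw [charFun_map_real (hpm.add_const c).aemeasurable]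
  have e2 (ω : MarkSpace) : Complex.exp ((1 : ℝ) * (pointSum f (ω p) + c : ℝ) * Complex.I) =
      Complex.exp ((1 : ℝ) * (pointSum f (ω p) : ℝ) * Complex.I) * Complex.exp (c * Complex.I) := by
    rw [← Complex.exp_add]; push_cast; ring_nf
  simp_rw [e2]
  rw [integral_mul_const, h1, ← Complex.exp_add, hc]
  congr 1
  push_cast
  rw [Finset.sum_mul, ← Finset.sum_add_distrib]
  refine Finset.sum_congr rfl fun j _ ↦ ?_
  have h2 := ofReal_add_I_mul_ne_zero hβ (θ j)
  have h3 : ((α + p.1 : ℝ) : ℂ) ≠ 0 := by exact_mod_cast hβ.ne'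
  have h4 : 1 + Complex.I * θ j / ((α + p.1 : ℝ) : ℂ) ≠ 0 :=
    Complex.slitPlane_ne_zero (one_add_I_mul_div_mem_slitPlane _ _)
  rw [levyTerm]
  push_cast at h2 h3 h4 ⊢
  have h5 : 1 / (1 + Complex.I * θ j / ((α : ℂ) + p.1)) - 1 =
      -(Complex.I * θ j / ((α : ℂ) + p.1 + Complex.I * θ j)) := by
    rw [show 1 + Complex.I * θ j / ((α : ℂ) + p.1) =
      ((α : ℂ) + p.1 + Complex.I * θ j) / ((α : ℂ) + p.1) by field_simp]
    field_simp
    ring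
  rw [h5]
  ring

/-- The characteristic exponent of an increment of `finiteJumps`. -/
noncomputable def finiteExponent (α : ℝ) (C : Finset (ℕ × ℕ)) (s t : ℝ≥0) (θ : ℝ) : ℂ :=
  ∑ p ∈ C, ((unitOverlap p.2 t - unitOverlap p.2 s : ℝ) : ℂ) * levyTerm (α + p.1) θ

lemma hasIncrementExponent_finiteJumps {α : ℝ} (hα : 0 < α) (C : Finset (ℕ × ℕ)) :
    HasIncrementExponent (finiteJumps α C) markMeasure (finiteExponent α C) := by
  intro s hs m θ
  have hm := measurable_blockJumps α
  set F : ℕ × ℕ → ℕ × (ℕ → ℝ × ℝ) → ℝ := fun p b ↦ ∑ j ∈ Finset.range m, θ j *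
    ((pointSum (markJump α p (s (j + 1))) b + unitOverlap p.2 (s (j + 1)) / (α + p.1)) -
      (pointSum (markJump α p (s j)) b + unitOverlap p.2 (s j) / (α + p.1))) with hF
  have hFm (p : ℕ × ℕ) : Measurable (F p) := by
    have := fun t ↦ measurable_pointSum (measurable_markJump α p t)
    fun_prop
  have e (ω : MarkSpace) : ∑ j ∈ Finset.range m, θ j *
      (finiteJumps α C (s (j + 1)) ω - finiteJumps α C (s j) ω) = ∑ p ∈ C, F p (ω p) := by
    simp only [finiteJumps, hF]
    rw [Finset.sum_comm]
    refine Finset.sum_congr rfl fun j _ ↦ ?_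
    rw [← Finset.sum_sub_distrib, Finset.mul_sum]
    refine Finset.sum_congr rfl fun p _ ↦ ?_
    rw [sub_sub_sub_cancel_right]
    rfl
  have hind := iIndepFun_infinitePi (P := fun _ : ℕ × ℕ ↦ poissonMarks markLaw) (X := F) hFm
  simp_rw [e]
  have h := congrFun (iIndepFun.charFun_map_fun_finsetSum_eq_prod (s := C) (P := markMeasure)
    (X := fun p ω ↦ F p (ω p)) (fun p _ ↦ ((hFm p).comp (measurable_pi_apply p)).aemeasurable)
    (iIndepFun.precomp (g := fun p : C ↦ (p : ℕ × ℕ)) Subtype.val_injective hind)) 1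
  rw [h, Finset.prod_apply]
  simp only [finiteExponent]
  rw [Finset.sum_comm, Complex.exp_sum]
  exact Finset.prod_congr rfl fun p _ ↦ charFun_blockJumps_increments hα p hs m θ

end Blocks

/-! ### Maximal inequalities -/

section MaximalInequality

variable {Ω : Type*} [MeasurableSpace Ω] {P : Measure Ω} [IsProbabilityMeasure P]

/-- **Kolmogorov's maximal inequality**. -/
lemma measure_exists_le_abs_sum_le {ξ : ℕ → Ω → ℝ} (hm : ∀ i, StronglyMeasurable (ξ i))
    (hind : iIndepFun ξ P) (hL : ∀ i, MemLp (ξ i) 2 P) (h0 : ∀ i, ∫ ω, ξ i ω ∂P = 0)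
    {ε : ℝ} (hε : 0 < ε) (n : ℕ) :
    P {ω | ∃ k ≤ n, ε ≤ |∑ i ∈ Finset.range (k + 1), ξ i ω|} ≤
      ENNReal.ofReal ((∫ ω, (∑ i ∈ Finset.range (n + 1), ξ i ω) ^ 2 ∂P) / ε ^ 2) := by
  set S : ℕ → Ω → ℝ := fun k ω ↦ ∑ i ∈ Finset.range (k + 1), ξ i ω with hS
  set 𝒢 := Filtration.natural ξ hm with h𝒢
  have hSL (k : ℕ) : MemLp (S k) 2 P := memLp_finsetSum _ fun i _ ↦ hL i
  have hξa : StronglyAdapted 𝒢 ξ := Filtration.stronglyAdapted_natural hm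
  have hSa : StronglyAdapted 𝒢 S := fun k ↦
    Finset.stronglyMeasurable_fun_sum _ fun i hi ↦
      (hξa i).mono (𝒢.mono (Nat.lt_succ_iff.1 (Finset.mem_range.1 hi)))
  have hsub : Submartingale (fun k ω ↦ S k ω ^ 2) 𝒢 P := by
    refine submartingale_nat (fun k ↦ (hSa k).pow 2) (fun k ↦ (hSL k).integrable_sq) fun k ↦ ?_
    have hprod : Integrable (fun ω ↦ (2 * S k ω) * ξ (k + 1) ω) P := by
      have := ((hSL k).const_mul 2).integrable_mul (hL (k + 1))
      exact this
    -- In `(S + ξ)² = S² + 2Sξ + ξ²` the cross term has conditional mean zero because `ξ` is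
    -- centered and independent of the past; so the squares form a submartingale.
    have hcross : P[fun ω ↦ (2 * S k ω) * ξ (k + 1) ω | 𝒢 k] =ᵐ[P] 0 := by
      have h1 := condExp_mul_of_stronglyMeasurable_left (μ := P) (m := 𝒢 k)
        ((hSa k).const_mul 2) hprod ((hL (k + 1)).integrable one_le_two)
      have h2 := hind.condExp_natural_ae_eq_of_lt hm (Nat.lt_succ_self k)
      refine h1.trans ?_
      filter_upwards [h2] with ω hω
      rw [Pi.mul_apply, hω, h0]
      simp
    have hint : Integrable (fun ω ↦ S k ω ^ 2 + (2 * S k ω) * ξ (k + 1) ω) P :=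
      (hSL k).integrable_sq.add hprod
    have hle : (fun ω ↦ S k ω ^ 2 + (2 * S k ω) * ξ (k + 1) ω) ≤ᵐ[P] fun ω ↦ S (k + 1) ω ^ 2 :=
      ae_of_all _ fun ω ↦ by
        have : S (k + 1) ω = S k ω + ξ (k + 1) ω := Finset.sum_range_succ _ _
        simp only [this]
        nlinarith [sq_nonneg (ξ (k + 1) ω)]
    have hmono := condExp_mono (m := 𝒢 k) hint (hSL (k + 1)).integrable_sq hle
    have hadd := condExp_add (m := 𝒢 k) (hSL k).integrable_sq hprod
    have hself : P[fun ω ↦ S k ω ^ 2 | 𝒢 k] = fun ω ↦ S k ω ^ 2 :=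
      condExp_of_stronglyMeasurable (𝒢.le k) ((hSa k).pow 2) (hSL k).integrable_sq
    filter_upwards [hmono, hadd, hcross] with ω h1 h2 h3
    refine le_trans (le_of_eq ?_) h1
    change _ = P[(fun ω ↦ S k ω ^ 2) + fun ω ↦ (2 * S k ω) * ξ (k + 1) ω | 𝒢 k] ω
    rw [h2, Pi.add_apply, h3, hself]
    simp
  have hε2 : 0 < ε ^ 2 := by positivity
  have key := maximal_ineq hsub (fun k ω ↦ sq_nonneg _) (ε := (ε ^ 2).toNNReal) n
  have hset : {ω | ∃ k ≤ n, ε ≤ |S k ω|} = {ω | (((ε ^ 2).toNNReal : ℝ≥0) : ℝ) ≤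
      (Finset.range (n + 1)).sup' Finset.nonempty_range_add_one fun k ↦ S k ω ^ 2} := by
    ext ω
    simp only [Set.mem_ofPred_eq, Finset.le_sup'_iff, Finset.mem_range, Nat.lt_succ_iff,
      Real.coe_toNNReal _ hε2.le]
    refine exists_congr fun k ↦ and_congr_right fun _ ↦ ?_
    rw [← sq_abs (S k ω), pow_le_pow_iff_left₀ hε.le (abs_nonneg _) two_ne_zero]
  change P {ω | ∃ k ≤ n, ε ≤ |S k ω|} ≤ _
  rw [hset, ENNReal.ofReal_div_of_pos hε2,
    ENNReal.le_div_iff_mul_le (Or.inl (by simpa using hε.ne'))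
    (Or.inl ENNReal.ofReal_ne_top), mul_comm]
  refine key.trans (ENNReal.ofReal_le_ofReal ?_)
  exact setIntegral_le_integral (hSL n).integrable_sq (ae_of_all _ fun ω ↦ sq_nonneg _)

/-- The strict inequality persists slightly to the right of `t`, and dyadic points of `[0, T]`
approach `t` from the right. The case `t = T` is itself a grid point. -/
lemma exists_dyadic_mem {f : ℝ≥0 → ℝ} (hf : ∀ t, ContinuousWithinAt f (Set.Ici t) t)
    {T t : ℝ≥0} (htT : t ≤ T) {ε : ℝ} (ht : ε < |f t|) :
    ∃ m k : ℕ, k ≤ 2 ^ m ∧ ε < |f (k * (T / 2 ^ m))| := by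
  rcases eq_or_lt_of_le htT with rfl | hlt
  · exact ⟨0, 1, by simp, by simpa using ht⟩
  have hT : 0 < T := (zero_le).trans_lt hlt
  have hev : ∀ᶠ r in 𝓝[≥] t, ε < |f r| := (hf t).tendsto.abs.eventually_const_lt ht
  set u : ℕ → ℝ≥0 := fun m ↦ ((⌊t / (T / 2 ^ m)⌋₊ + 1 : ℕ) : ℝ≥0) * (T / 2 ^ m) with hu
  have hh (m : ℕ) : 0 < T / 2 ^ m := by positivity
  have h1 (m : ℕ) : t ≤ u m := by
    have := (Nat.lt_floor_add_one (t / (T / 2 ^ m))).le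
    rw [div_le_iff₀ (hh m)] at this
    simpa only [hu, Nat.cast_add, Nat.cast_one] using this
  have h2 (m : ℕ) : u m ≤ t + T / 2 ^ m := by
    have := Nat.floor_le (zero_le (a := t / (T / 2 ^ m)))
    rw [le_div_iff₀ (hh m)] at this
    simp only [hu]
    push_cast
    rw [add_mul, one_mul]
    gcongr
  have h3 : Tendsto u atTop (𝓝[≥] t) := by
    refine tendsto_nhdsWithin_iff.2 ⟨?_, Eventually.of_forall h1⟩
    refine tendsto_of_tendsto_of_tendsto_of_le_of_le tendsto_const_nhds
      (h := fun m : ℕ ↦ t + T / 2 ^ m) ?_ h1 h2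
    have : Tendsto (fun m : ℕ ↦ T / 2 ^ m) atTop (𝓝 0) := by
      have := (NNReal.tendsto_pow_atTop_nhds_zero_of_lt_one
        (r := 1 / 2) (by norm_num)).const_mul T
      simpa [div_eq_mul_inv] using this
    simpa using this.const_add t
  obtain ⟨m, hm⟩ := (h3.eventually hev).exists
  refine ⟨m, _, ?_, hm⟩
  have : ⌊t / (T / 2 ^ m)⌋₊ < 2 ^ m := by
    rw [Nat.floor_lt zero_le, div_lt_iff₀ (hh m)]
    push_cast
    rwa [mul_div_cancel₀ _ (by positivity)]
  exact this

/-- **Doob's `L²` maximal inequality** for a process with independent centered increments and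
right-continuous paths. -/
lemma measure_exists_lt_abs_le {Z : ℝ≥0 → Ω → ℝ} (hm : ∀ t, Measurable (Z t))
    (hind : HasIndepIncrements Z P) (hL : ∀ s t, s ≤ t → MemLp (fun ω ↦ Z t ω - Z s ω) 2 P)
    (h0 : ∀ s t, s ≤ t → ∫ ω, (Z t ω - Z s ω) ∂P = 0) (hz : ∀ ω, Z 0 ω = 0)
    (hc : ∀ ω t, ContinuousWithinAt (fun r ↦ Z r ω) (Set.Ici t) t) {ε : ℝ} (hε : 0 < ε)
    (T : ℝ≥0) :
    P {ω | ∃ t ≤ T, ε < |Z t ω|} ≤ ENNReal.ofReal ((∫ ω, Z T ω ^ 2 ∂P) / ε ^ 2) := by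
  set A : ℕ → Set Ω := fun m ↦ {ω | ∃ k : ℕ, k ≤ 2 ^ m ∧ ε < |Z (k * (T / 2 ^ m)) ω|}
    with hA
  have hsub : {ω | ∃ t ≤ T, ε < |Z t ω|} ⊆ ⋃ m, A m := by
    rintro ω ⟨t, htT, ht⟩
    obtain ⟨m, k, hk, h⟩ := exists_dyadic_mem (hc ω) htT ht
    exact Set.mem_iUnion.2 ⟨m, k, hk, h⟩
  have hmono : Monotone A := monotone_nat_of_le_succ fun m ω ⟨k, hk, h⟩ ↦ by
    refine ⟨2 * k, by rw [pow_succ]; omega, ?_⟩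
    have : ((2 * k : ℕ) : ℝ≥0) * (T / 2 ^ (m + 1)) = k * (T / 2 ^ m) := by
      push_cast; rw [pow_succ]; field_simp
    rwa [this]
  refine (measure_mono hsub).trans ?_
  rw [hmono.measure_iUnion]
  refine iSup_le fun m ↦ ?_
  -- The discrete inequality bounds sums of `k + 1` terms with `k ≤ n`; this choice makes the last
  -- one `Z T`. The grid point `0` is treated apart.
  obtain ⟨n, hn⟩ : ∃ n : ℕ, 2 ^ m = n + 1 := ⟨2 ^ m - 1, by
    have := Nat.one_le_two_pow (n := m); omega⟩
  set τ : ℕ → ℝ≥0 := fun k ↦ k * (T / 2 ^ m) with hτ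
  have hτm : Monotone τ := fun i j hij ↦ by simp only [hτ]; gcongr
  have htel (k : ℕ) (ω : Ω) : ∑ i ∈ Finset.range k, (Z (τ (i + 1)) ω - Z (τ i) ω) = Z (τ k) ω := by
    rw [Finset.sum_range_sub fun i ↦ Z (τ i) ω]
    simp [hτ, hz]
  have hkol : P {ω | ∃ k ≤ n, ε ≤ |∑ i ∈ Finset.range (k + 1), (Z (τ (i + 1)) ω - Z (τ i) ω)|} ≤
      ENNReal.ofReal ((∫ ω, (∑ i ∈ Finset.range (n + 1), (Z (τ (i + 1)) ω - Z (τ i) ω)) ^ 2 ∂P)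
        / ε ^ 2) := measure_exists_le_abs_sum_le (fun i ↦ ((hm (τ (i + 1))).sub
    (hm (τ i))).stronglyMeasurable) (hind.nat hτm) (fun i ↦ hL _ _ (hτm i.le_succ))
    (fun i ↦ h0 _ _ (hτm i.le_succ)) hε n
  have hT : τ (n + 1) = T := by
    simp only [hτ]
    rw [← hn]
    push_cast
    exact mul_div_cancel₀ _ (by positivity)
  simp_rw [htel, hT] at hkol
  refine (measure_mono ?_).trans hkol
  rintro ω ⟨k, hk, h⟩
  rcases k with _ | k
  · simp [hz] at h
    exact absurd h hε.not_gt
  · exact ⟨k, by omega, h.le⟩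

end MaximalInequality

/-! ### Càdlàg paths and their uniform limits -/

section Cadlag

/-- Right-continuity with left limits. -/
def IsCadlag (f : ℝ≥0 → ℝ) : Prop :=
  ∀ t, ContinuousWithinAt f (Set.Ici t) t ∧ ∃ l : ℝ, Tendsto f (𝓝[<] t) (𝓝 l)

lemma Continuous.isCadlag {f : ℝ≥0 → ℝ} (hf : Continuous f) : IsCadlag f := fun t ↦
  ⟨hf.continuousWithinAt, f t, hf.continuousWithinAt⟩

lemma IsCadlag.add {f g : ℝ≥0 → ℝ} (hf : IsCadlag f) (hg : IsCadlag g) :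
    IsCadlag fun t ↦ f t + g t := fun t ↦ by
  obtain ⟨h1, l1, h2⟩ := hf t
  obtain ⟨h3, l3, h4⟩ := hg t
  exact ⟨h1.add h3, _, h2.add h4⟩

lemma IsCadlag.sum {ι : Type*} {s : Finset ι} {f : ι → ℝ≥0 → ℝ} (hf : ∀ i ∈ s, IsCadlag (f i)) :
    IsCadlag fun t ↦ ∑ i ∈ s, f i t := fun t ↦ by
  refine ⟨tendsto_finsetSum _ fun i hi ↦ (hf i hi t).1, ?_⟩
  choose! l hl using fun i hi ↦ (hf i hi t).2
  exact ⟨_, tendsto_finsetSum _ hl⟩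

lemma isCadlag_markJump (α : ℝ) (p : ℕ × ℕ) (e : ℝ × ℝ) :
    IsCadlag fun t : ℝ≥0 ↦ markJump α p t e := fun t ↦ by
  have hc : Continuous fun r : ℝ≥0 ↦ (r : ℝ) := NNReal.continuous_coe
  constructor
  · by_cases h : p.2 + e.1 ≤ t
    · refine tendsto_const_nhds.congr' (f₁ := fun _ ↦ markJump α p t e) ?_
      filter_upwards [self_mem_nhdsWithin] with r hr
      have : (t : ℝ) ≤ r := by exact_mod_cast hr
      simp [markJump, h, h.trans this]
    · refine tendsto_const_nhds.congr' (f₁ := fun _ ↦ markJump α p t e) ?_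
      filter_upwards [mem_nhdsWithin_of_mem_nhds
        (hc.continuousAt.eventually_lt_const (not_le.1 h))] with r hr
      have hr' : ¬ (p.2 + e.1 ≤ r) := not_le.2 hr
      simp [markJump, h, hr']
  · by_cases h : p.2 + e.1 < t
    · refine ⟨-(e.2 / (α + p.1)), tendsto_const_nhds.congr' ?_⟩
      filter_upwards [mem_nhdsWithin_of_mem_nhds
        (hc.continuousAt.eventually_const_lt h)] with r hr
      have hr' : p.2 + e.1 ≤ r := le_of_lt hr
      simp [markJump, hr']
    · refine ⟨0, tendsto_const_nhds.congr' ?_⟩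
      filter_upwards [self_mem_nhdsWithin] with r hr
      have : (r : ℝ) < t := by exact_mod_cast hr
      have hr' : ¬ (p.2 + e.1 ≤ r) := by rw [not_le]; linarith
      simp [markJump, hr']

lemma isCadlag_finiteJumps (α : ℝ) (C : Finset (ℕ × ℕ)) (ω : MarkSpace) :
    IsCadlag fun t ↦ finiteJumps α C t ω := by
  refine IsCadlag.sum fun p _ ↦ ?_
  have h1 : IsCadlag fun t ↦ blockJumps α p t ω := by
    refine (IsCadlag.sum fun i _ ↦ isCadlag_markJump α p ((ω p).2 i)).add
      (Continuous.isCadlag ?_)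
    exact ((continuous_unitOverlap _).comp NNReal.continuous_coe).div_const _
  simp_rw [sub_eq_add_neg]
  exact h1.add continuous_const.isCadlag

/-- Paths with geometrically summable differences, locally uniformly, converge to a càdlàg path. -/
lemma exists_isCadlag_limit {f : ℕ → ℝ≥0 → ℝ} (hf : ∀ j, IsCadlag (f j))
    (h : ∀ T : ℕ, ∀ᶠ j in atTop, ∀ t : ℝ≥0, t ≤ T → |f (j + 1) t - f j t| ≤ (1 / 2) ^ j) :
    ∃ g : ℝ≥0 → ℝ, IsCadlag g ∧ ∀ t, Tendsto (fun j ↦ f j t) atTop (𝓝 (g t)) := by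
  have hcauchy (u : ℕ → ℝ) (N : ℕ) (hu : ∀ j ≥ N, |u (j + 1) - u j| ≤ (1 / 2) ^ j) :
      ∃ l, Tendsto u atTop (𝓝 l) ∧ ∀ j ≥ N, |u j - l| ≤ 2 * (1 / 2) ^ j := by
    have h1 : ∀ j ≥ N, ∀ n, dist (u (j + n)) (u (j + (n + 1))) ≤ (1 / 2) ^ j * (1 / 2) ^ n := by
      intro j hj n
      rw [dist_comm, Real.dist_eq, ← pow_add]
      exact hu (j + n) (by omega)
    have h2 : ∀ j ≥ N, CauchySeq fun n ↦ u (j + n) := fun j hj ↦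
      cauchySeq_of_le_geometric (1 / 2) _ (by norm_num) (h1 j hj)
    obtain ⟨l, hl⟩ := cauchySeq_tendsto_of_complete (h2 N le_rfl)
    have hl' : Tendsto u atTop (𝓝 l) := by
      simp_rw [add_comm N] at hl
      exact (tendsto_add_atTop_iff_nat N).1 hl
    refine ⟨l, hl', fun j hj ↦ ?_⟩
    have h3 := dist_le_of_le_geometric_of_tendsto₀ (1 / 2) _ (by norm_num) (h1 j hj)
      (hl'.comp (tendsto_atTop_mono (fun n ↦ Nat.le_add_left n j) tendsto_id) :
        Tendsto (fun n ↦ u (j + n)) atTop (𝓝 l))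
    rw [Real.dist_eq, add_zero] at h3
    calc _ ≤ _ := h3
      _ = _ := by ring
  have hT (T : ℕ) : ∃ N, ∀ j ≥ N, ∀ t : ℝ≥0, t ≤ T → |f (j + 1) t - f j t| ≤ (1 / 2) ^ j :=
    eventually_atTop.1 (h T)
  choose N hN using hT
  have hex (t : ℝ≥0) : ∃ l, Tendsto (fun j ↦ f j t) atTop (𝓝 l) := by
    obtain ⟨l, hl, -⟩ := hcauchy (fun j ↦ f j t) (N ⌈t⌉₊) fun j hj ↦
      hN _ j hj t (Nat.le_ceil t)
    exact ⟨l, hl⟩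
  choose g hg using hex
  have hunif (T : ℕ) : TendstoUniformlyOn f g atTop (Set.Iic (T : ℝ≥0)) := by
    rw [Metric.tendstoUniformlyOn_iff]
    intro ε hε
    have h0 : Tendsto (fun j : ℕ ↦ 2 * (1 / 2 : ℝ) ^ j) atTop (𝓝 0) := by
      simpa using (tendsto_pow_atTop_nhds_zero_of_lt_one (r := (1 / 2 : ℝ)) (by norm_num)
        (by norm_num)).const_mul 2
    filter_upwards [h0.eventually_lt_const hε, eventually_ge_atTop (N T)] with j hj hjN t ht
    obtain ⟨l, hl, hl2⟩ := hcauchy (fun j ↦ f j t) (N T) fun j hj ↦ hN _ j hj t ht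
    rw [tendsto_nhds_unique (hg t) hl, dist_comm, Real.dist_eq]
    exact (hl2 j hjN).trans_lt hj
  refine ⟨g, fun t ↦ ?_, hg⟩
  obtain ⟨T, hTt⟩ : ∃ T : ℕ, t < T := exists_nat_gt t
  have hmem : Set.Iic (T : ℝ≥0) ∈ 𝓝 t := Iic_mem_nhds hTt
  have hfil (l : Filter ℝ≥0) (hl : l ≤ 𝓝 t) : TendstoUniformlyOnFilter f g atTop l :=
    (hunif T).tendstoUniformlyOnFilter.mono_right (le_principal_iff.2 (hl hmem))
  refine ⟨?_, ?_⟩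
  · exact (hfil _ nhdsWithin_le_nhds).tendsto_of_eventually_tendsto
      (Eventually.of_forall fun j ↦ (hf j t).1) (hg t)
  · choose L hL using fun j ↦ (hf j t).2
    -- At `t = 0` the left filter is trivial. Otherwise the geometric bound passes to the left
    -- limits `L j`, which are therefore Cauchy.
    rcases eq_or_neBot (𝓝[<] t) with hbot | hbot
    · exact ⟨0, by rw [hbot]; exact tendsto_bot⟩
    have hLc : ∀ j ≥ N T, |L (j + 1) - L j| ≤ (1 / 2) ^ j := fun j hj ↦ by
      refine le_of_tendsto ((hL (j + 1)).sub (hL j)).abs ?_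
      filter_upwards [self_mem_nhdsWithin] with r hr
      exact hN T j hj r ((le_of_lt hr).trans hTt.le)
    obtain ⟨l, hl, -⟩ := hcauchy L (N T) hLc
    exact ⟨l, (hfil _ nhdsWithin_le_nhds).tendsto_of_eventually_tendsto
      (Eventually.of_forall hL) hl⟩

end Cadlag

/-! ### Summing infinitely many families of jumps -/

section LimitJumps

/-- Subtracting the value at `0` makes this hold for every `ω`, including those with marks
positioned outside `(0, 1]`; the maximal inequality asks for it everywhere. -/
lemma finiteJumps_zero (α : ℝ) (C : Finset (ℕ × ℕ)) (ω : MarkSpace) :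
    finiteJumps α C 0 ω = 0 := by
  simp [finiteJumps]

/-- The exponent is at most `V θ²`, so near `0` the characteristic function differs from `1` by at
most `2V θ²`; the moment lemma with `K = 2V` yields `4V`. -/
lemma moments_finiteJumps {α : ℝ} (hα : 0 < α) (C : Finset (ℕ × ℕ)) {s t : ℝ≥0} (hst : s ≤ t) :
    MemLp (fun ω ↦ finiteJumps α C t ω - finiteJumps α C s ω) 2 markMeasure ∧
    ∫ ω, (finiteJumps α C t ω - finiteJumps α C s ω) ∂markMeasure = 0 ∧
    ∫ ω, (finiteJumps α C t ω - finiteJumps α C s ω) ^ 2 ∂markMeasure ≤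
      4 * ∑ p ∈ C, (unitOverlap p.2 t - unitOverlap p.2 s) * (1 / (α + p.1) ^ 2) := by
  set V := ∑ p ∈ C, (unitOverlap p.2 t - unitOverlap p.2 s) * (1 / (α + p.1) ^ 2)
  have hm : Measurable fun ω ↦ finiteJumps α C t ω - finiteJumps α C s ω :=
    (measurable_finiteJumps α C t).sub (measurable_finiteJumps α C s)
  have : IsProbabilityMeasure
      (markMeasure.map fun ω ↦ finiteJumps α C t ω - finiteJumps α C s ω) :=
    Measure.isProbabilityMeasure_map hm.aemeasurable
  have hexp (θ : ℝ) : ‖finiteExponent α C s t θ‖ ≤ V * θ ^ 2 := by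
    refine (norm_sum_le _ _).trans ?_
    rw [Finset.sum_mul]
    refine Finset.sum_le_sum fun p _ ↦ ?_
    have h1 : 0 ≤ unitOverlap p.2 t - unitOverlap p.2 s :=
      sub_nonneg.2 (unitOverlap_mono _ (by exact_mod_cast hst))
    rw [norm_mul, Complex.norm_real, Real.norm_of_nonneg h1, mul_assoc, mul_comm (1 / _)]
    gcongr
    exact norm_levyTerm_le (by positivity) θ
  have hsmall : ∀ᶠ θ : ℝ in 𝓝 0, V * θ ^ 2 < 1 := by
    have hc : Continuous fun θ : ℝ ↦ V * θ ^ 2 := by fun_prop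
    exact hc.continuousAt.eventually_lt_const (by simp)
  obtain ⟨h1, h2, h3⟩ := moments_of_norm_charFun_sub_one_le (K := 2 * V)
    (μ := markMeasure.map fun ω ↦ finiteJumps α C t ω - finiteJumps α C s ω) (by
      filter_upwards [hsmall] with θ hθ
      rw [(hasIncrementExponent_finiteJumps hα C).charFun_sub hst (measurable_finiteJumps α C)]
      refine (Complex.norm_exp_sub_one_le ((hexp θ).trans hθ.le)).trans ?_
      linarith [hexp θ])
  rw [integral_map hm.aemeasurable (by fun_prop)] at h2 h3
  refine ⟨(memLp_map_measure_iff (by fun_prop) hm.aemeasurable).1 h1, h3, h2.trans (by linarith)⟩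

/-- An exhausting sequence of finite sets of families of marks. -/
def familySet (j : ℕ) : Finset (ℕ × ℕ) := Finset.range (8 ^ j) ×ˢ Finset.range j

lemma familySet_subset_succ (j : ℕ) : familySet j ⊆ familySet (j + 1) :=
  Finset.product_subset_product
    (Finset.range_mono (Nat.pow_le_pow_right (by norm_num) j.le_succ))
    (Finset.range_mono j.le_succ)

lemma finiteJumps_sub_of_subset (α : ℝ) {C D : Finset (ℕ × ℕ)} (h : C ⊆ D) (t : ℝ≥0)
    (ω : MarkSpace) :
    finiteJumps α D t ω - finiteJumps α C t ω = finiteJumps α (D \ C) t ω := by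
  rw [finiteJumps, finiteJumps, ← Finset.sum_sdiff h, add_sub_cancel_right, finiteJumps]

/-- Up to time `j` only new families with `p.2 < j` matter, and these have `p.1 ≥ 8^j`. At most
`8^{j+1} (j+1)` terms of size `8^{-2j}` leave `8^{-j}` up to a linear factor. Base `8` is large
enough to survive division by `4^{-j}`, the squared threshold in the maximal inequality. -/
lemma sum_familySet_sdiff_le {α : ℝ} (hα : 0 < α) (j : ℕ) :
    ∑ p ∈ familySet (j + 1) \ familySet j, (unitOverlap p.2 ((j : ℝ≥0) : ℝ) -
      unitOverlap p.2 ((0 : ℝ≥0) : ℝ)) * (1 / (α + p.1) ^ 2) ≤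
      8 * ((j : ℝ) + 1) * (1 / 8 : ℝ) ^ j := by
  have hterm : ∀ p ∈ familySet (j + 1) \ familySet j,
      (unitOverlap p.2 ((j : ℝ≥0) : ℝ) - unitOverlap p.2 ((0 : ℝ≥0) : ℝ)) *
        (1 / (α + p.1) ^ 2) ≤ 1 / ((8 : ℝ) ^ j) ^ 2 := by
    intro p hp
    rw [Finset.mem_sdiff, familySet, familySet, Finset.mem_product, Finset.mem_product,
      Finset.mem_range, Finset.mem_range, Finset.mem_range, Finset.mem_range] at hp
    have h0 : unitOverlap p.2 ((0 : ℝ≥0) : ℝ) = 0 := unitOverlap_eq_zero (by simp)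
    rw [h0, sub_zero]
    by_cases hn : p.2 < j
    · have hk : 8 ^ j ≤ p.1 := not_lt.1 fun h ↦ hp.2 ⟨h, hn⟩
      have hk' : (8 : ℝ) ^ j ≤ p.1 := by exact_mod_cast hk
      calc _ ≤ 1 * (1 / ((8 : ℝ) ^ j) ^ 2) := by
            gcongr
            · exact unitOverlap_le_one _ _
            · linarith
        _ = _ := one_mul _
    · rw [unitOverlap_eq_zero (by simpa using hn), zero_mul]
      positivity
  refine (Finset.sum_le_card_nsmul _ _ _ hterm).trans ?_
  have hcard : (familySet (j + 1) \ familySet j).card ≤ 8 ^ (j + 1) * (j + 1) := by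
    refine (Finset.card_le_card Finset.sdiff_subset).trans ?_
    simp [familySet]
  have hcard' : ((familySet (j + 1) \ familySet j).card : ℝ) ≤ 8 ^ (j + 1) * (j + 1) := by
    exact_mod_cast hcard
  rw [nsmul_eq_mul]
  calc _ ≤ ((8 : ℝ) ^ (j + 1) * (j + 1)) * (1 / ((8 : ℝ) ^ j) ^ 2) := by gcongr
    _ = _ := by rw [pow_succ, one_div_pow]; field_simp

lemma measure_exists_lt_abs_finiteJumps_sub_le {α : ℝ} (hα : 0 < α) (j : ℕ) :
    markMeasure {ω | ∃ t ≤ (j : ℝ≥0), (1 / 2) ^ j <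
      |finiteJumps α (familySet (j + 1)) t ω - finiteJumps α (familySet j) t ω|} ≤
      ENNReal.ofReal (32 * ((j + 1) * (1 / 2) ^ j)) := by
  set C := familySet (j + 1) \ familySet j
  simp_rw [finiteJumps_sub_of_subset α (familySet_subset_succ j)]
  have hm := measurable_finiteJumps α C
  refine (measure_exists_lt_abs_le hm
    ((hasIncrementExponent_finiteJumps hα C).hasIndepIncrements hm)
    (fun s t hst ↦ (moments_finiteJumps hα C hst).1)
    (fun s t hst ↦ (moments_finiteJumps hα C hst).2.1) (finiteJumps_zero α C)
    (fun ω t ↦ (isCadlag_finiteJumps α C ω t).1) (by positivity) j).trans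
    (ENNReal.ofReal_le_ofReal ?_)
  have h1 := (moments_finiteJumps hα C (zero_le (a := (j : ℝ≥0)))).2.2
  simp only [finiteJumps_zero, sub_zero] at h1
  rw [div_le_iff₀ (by positivity)]
  calc _ ≤ _ := h1
    _ ≤ 4 * (8 * (j + 1) * (1 / 8) ^ j) := by gcongr; exact sum_familySet_sdiff_le hα j
    _ = _ := by
      rw [show (1 / 8 : ℝ) = (1 / 2) * (1 / 2) ^ 2 by norm_num, mul_pow, ← pow_mul, ← pow_mul,
        mul_comm 2 j]
      ring

/-- The limit of the compensated sums of jumps. -/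
noncomputable def limitJumps (α : ℝ) (t : ℝ≥0) (ω : MarkSpace) : ℝ :=
  limsup (fun j ↦ finiteJumps α (familySet j) t ω) atTop

/-- The `limsup` is defined for every `ω`, so joint measurability is inherited; it is needed later
to integrate paths in time. -/
lemma measurable_limitJumps_uncurry (α : ℝ) :
    Measurable fun z : ℝ≥0 × MarkSpace ↦ limitJumps α z.1 z.2 := by
  exact Measurable.limsup fun j ↦ measurable_finiteJumps_uncurry α (familySet j)

lemma measurable_limitJumps (α : ℝ) (t : ℝ≥0) : Measurable (limitJumps α t) := by
  exact Measurable.limsup fun j ↦ measurable_finiteJumps α (familySet j) t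

lemma limitJumps_zero (α : ℝ) (ω : MarkSpace) : limitJumps α 0 ω = 0 := by
  simp [limitJumps, finiteJumps_zero]

/-- The exceptional probabilities are summable, so by Borel–Cantelli successive differences are
eventually at most `2^{-j}` on `[0, j]`. -/
lemma ae_isCadlag_limitJumps {α : ℝ} (hα : 0 < α) :
    ∀ᵐ ω ∂markMeasure, IsCadlag (fun t ↦ limitJumps α t ω) ∧
      ∀ t, Tendsto (fun j ↦ finiteJumps α (familySet j) t ω) atTop (𝓝 (limitJumps α t ω)) := by
  have hsum : Summable fun j : ℕ ↦ 32 * (((j : ℝ) + 1) * (1 / 2) ^ j) := by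
    have h1 := summable_pow_mul_geometric_of_norm_lt_one 1 (r := (1 / 2 : ℝ)) (by norm_num)
    have h2 := summable_geometric_of_lt_one (r := (1 / 2 : ℝ)) (by norm_num) (by norm_num)
    refine ((h1.add h2).congr fun j ↦ ?_).mul_left 32
    ring
  have hBC := ae_eventually_notMem (μ := markMeasure) (s := fun j : ℕ ↦
    {ω | ∃ t ≤ (j : ℝ≥0), (1 / 2) ^ j <
      |finiteJumps α (familySet (j + 1)) t ω - finiteJumps α (familySet j) t ω|}) (by
    refine ne_top_of_le_ne_top ?_ (ENNReal.tsum_le_tsum fun j ↦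
      measure_exists_lt_abs_finiteJumps_sub_le hα j)
    rw [← ENNReal.ofReal_tsum_of_nonneg (fun j ↦ by positivity) hsum]
    exact ENNReal.ofReal_ne_top)
  filter_upwards [hBC] with ω hω
  obtain ⟨g, hg, hlim⟩ := exists_isCadlag_limit
    (f := fun j t ↦ finiteJumps α (familySet j) t ω)
    (fun j ↦ isCadlag_finiteJumps α (familySet j) ω) fun T ↦ by
      filter_upwards [hω, eventually_ge_atTop T] with j hj hjT t ht
      by_contra hcon
      exact hj ⟨t, ht.trans (by exact_mod_cast hjT), not_le.1 hcon⟩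
  have heq (t : ℝ≥0) : limitJumps α t ω = g t := (hlim t).limsup_eq
  simp_rw [heq]
  exact ⟨hg, hlim⟩

/-- Once `j` exceeds both times, the unit blocks cover the interval, so their overlaps add up to its
length and the exponent becomes time-homogeneous. -/
lemma finiteExponent_familySet {α : ℝ} {s t : ℝ≥0} {j : ℕ} (hs : (s : ℝ) ≤ j) (ht : (t : ℝ) ≤ j)
    (θ : ℝ) : finiteExponent α (familySet j) s t θ =
      ((t - s : ℝ) : ℂ) * ∑ k ∈ Finset.range (8 ^ j), levyTerm (α + k) θ := by
  rw [finiteExponent, familySet, Finset.sum_product_right]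
  simp_rw [← Finset.mul_sum]
  rw [← Finset.sum_mul]
  congr 1
  rw [← Complex.ofReal_sum, Finset.sum_sub_distrib, sum_unitOverlap (NNReal.coe_nonneg t) ht,
    sum_unitOverlap (NNReal.coe_nonneg s) hs]

lemma hasIncrementExponent_limitJumps {α : ℝ} (hα : 0 < α) :
    HasIncrementExponent (limitJumps α) markMeasure
      (fun s t θ ↦ ((t - s : ℝ) : ℂ) * ∑' k : ℕ, levyTerm (α + k) θ) := by
  intro s hs m θ
  have hm1 := measurable_finiteJumps α
  have hm2 := measurable_limitJumps α
  have h1 := tendsto_charFun_of_tendsto_ae (P := markMeasure) (l := atTop)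
    (X := fun J ω ↦ ∑ j ∈ Finset.range m, θ j *
      (finiteJumps α (familySet J) (s (j + 1)) ω - finiteJumps α (familySet J) (s j) ω))
    (Z := fun ω ↦ ∑ j ∈ Finset.range m, θ j *
      (limitJumps α (s (j + 1)) ω - limitJumps α (s j) ω))
    (fun J ↦ by fun_prop) (by fun_prop) (by
      filter_upwards [ae_isCadlag_limitJumps hα] with ω hω
      exact tendsto_finsetSum _ fun j _ ↦ ((hω.2 _).sub (hω.2 _)).const_mul _) 1
  simp_rw [fun J ↦ hasIncrementExponent_finiteJumps hα (familySet J) s hs m θ] at h1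
  refine tendsto_nhds_unique h1 ((Complex.continuous_exp.tendsto _).comp ?_)
  refine tendsto_finsetSum _ fun j _ ↦ ?_
  have h2 : Tendsto (fun J : ℕ ↦ ∑ k ∈ Finset.range (8 ^ J), levyTerm (α + k) (θ j)) atTop
      (𝓝 (∑' k : ℕ, levyTerm (α + k) (θ j))) :=
    (summable_levyTerm hα (θ j)).hasSum.tendsto_sum_nat.comp
      (tendsto_pow_atTop_atTop_of_one_lt (by norm_num))
  refine (h2.const_mul _).congr' ?_
  filter_upwards [eventually_ge_atTop ⌈(s (j + 1) : ℝ)⌉₊] with J hJ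
  have h3 : (s (j + 1) : ℝ) ≤ J := (Nat.le_ceil _).trans (by exact_mod_cast hJ)
  exact (finiteExponent_familySet (le_trans (by exact_mod_cast hs j.le_succ) h3) h3 _).symm

/-- Fatou's lemma along the finite sums, with `|x| ≤ 1 + x²` to use the variance bound. -/
lemma lintegral_enorm_limitJumps_le {α : ℝ} (hα : 0 < α) (t : ℝ≥0) :
    ∫⁻ ω, ‖limitJumps α t ω‖ₑ ∂markMeasure ≤
      ENNReal.ofReal (1 + 4 * (∑' k : ℕ, 1 / (α + k) ^ 2) * t) := by
  have hbound : ∀ᶠ j in atTop, ∫⁻ ω, ‖finiteJumps α (familySet j) t ω‖ₑ ∂markMeasure ≤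
      ENNReal.ofReal (1 + 4 * (∑' k : ℕ, 1 / (α + k) ^ 2) * t) := by
    filter_upwards [eventually_ge_atTop ⌈(t : ℝ)⌉₊] with j hj
    have hj' : (t : ℝ) ≤ j := (Nat.le_ceil _).trans (by exact_mod_cast hj)
    obtain ⟨h1, -, h3⟩ := moments_finiteJumps hα (familySet j) (zero_le (a := t))
    simp only [finiteJumps_zero, sub_zero] at h1 h3
    have hsq := h1.integrable_sq
    have hV : ∑ p ∈ familySet j, (unitOverlap p.2 (t : ℝ) -
        unitOverlap p.2 ((0 : ℝ≥0) : ℝ)) * (1 / (α + p.1) ^ 2) ≤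
          (∑' k : ℕ, 1 / (α + k) ^ 2) * (t : ℝ) := by
      have h0 (n : ℕ) : unitOverlap n ((0 : ℝ≥0) : ℝ) = 0 := unitOverlap_eq_zero (by simp)
      simp_rw [h0, sub_zero]
      rw [familySet, Finset.sum_product_right]
      simp_rw [← Finset.mul_sum]
      rw [← Finset.sum_mul, sum_unitOverlap (NNReal.coe_nonneg t) hj', mul_comm]
      gcongr
      exact (summable_inv_sq_add hα).sum_le_tsum _ fun k _ ↦ by positivity
    calc ∫⁻ ω, ‖finiteJumps α (familySet j) t ω‖ₑ ∂markMeasure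
        ≤ ∫⁻ ω, ENNReal.ofReal (1 + finiteJumps α (familySet j) t ω ^ 2) ∂markMeasure := by
          refine lintegral_mono fun ω ↦ ?_
          rw [Real.enorm_eq_ofReal_abs]
          refine ENNReal.ofReal_le_ofReal ?_
          rw [← sq_abs]
          nlinarith [sq_nonneg (|finiteJumps α (familySet j) t ω| - 1)]
      _ = ENNReal.ofReal (∫ ω, (1 + finiteJumps α (familySet j) t ω ^ 2) ∂markMeasure) := by
          rw [ofReal_integral_eq_lintegral_ofReal (by exact (integrable_const _).add hsq)
            (ae_of_all _ fun ω ↦ by positivity)]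
      _ ≤ _ := by
          refine ENNReal.ofReal_le_ofReal ?_
          rw [integral_add (integrable_const _) hsq]
          simp only [integral_const, probReal_univ, one_smul]
          linarith
  calc ∫⁻ ω, ‖limitJumps α t ω‖ₑ ∂markMeasure
      = ∫⁻ ω, liminf (fun j ↦ ‖finiteJumps α (familySet j) t ω‖ₑ) atTop ∂markMeasure := by
        refine lintegral_congr_ae ?_
        filter_upwards [ae_isCadlag_limitJumps hα] with ω hω
        exact ((hω.2 t).enorm).liminf_eq.symm
    _ ≤ liminf (fun j ↦ ∫⁻ ω, ‖finiteJumps α (familySet j) t ω‖ₑ ∂markMeasure) atTop :=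
        lintegral_liminf_le fun j ↦ (measurable_finiteJumps _ _ _).enorm
    _ ≤ _ := liminf_le_of_le (by isBoundedDefault) fun b hb ↦ by
        obtain ⟨n, h1, h2⟩ := (hb.and hbound).exists
        exact h1.trans h2

end LimitJumps

/-! ### Convergence of the exponential integral -/

section ExpIntegral

variable {Ω : Type*} [MeasurableSpace Ω] {P : Measure Ω} [IsProbabilityMeasure P]

/-- If `𝔼|Y(t)|` grows at most linearly, then `∫_{(0,T]} e^{-s} dY(s)` converges in probability. -/
lemma IsLevyProcess.exists_tendstoInMeasure_expIntegral {Y : ℝ≥0 → Ω → ℝ} (hY : IsLevyProcess Y P)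
    (hYm : Measurable fun z : ℝ≥0 × Ω ↦ Y z.1 z.2) {C : ℝ} (hC : 0 ≤ C)
    (hYC : ∀ t : ℝ≥0, ∫⁻ ω, ‖Y t ω‖ₑ ∂P ≤ ENNReal.ofReal (C * (1 + t))) :
    ∃ X : Ω → ℝ, Measurable X ∧ TendstoInMeasure P (expIntegral Y) atTop X := by
  set f : Ω × ℝ → ℝ := fun z ↦ Real.exp (-z.2) * Y z.2.toNNReal z.1 with hf
  have hfm : Measurable f := by
    have h1 : Measurable fun z : Ω × ℝ ↦ (z.2.toNNReal, z.1) := by fun_prop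
    have h2 : Measurable fun z : Ω × ℝ ↦ Y z.2.toNNReal z.1 := hYm.comp h1
    fun_prop
  -- From `1 + t ≤ 2 e^{t/2}`: half of the exponential decay pays for the linear growth.
  have hexp (t : ℝ≥0) : Real.exp (-(t : ℝ)) * (C * (1 + t)) ≤ 2 * C * Real.exp (-1 / 2 * t) := by
    have h1 := Real.add_one_le_exp ((t : ℝ) / 2)
    have h2 : Real.exp (-(t : ℝ)) * Real.exp (t / 2) = Real.exp (-1 / 2 * t) := by
      rw [← Real.exp_add]; ring_nf
    have ht : (0 : ℝ) ≤ t := t.2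
    calc Real.exp (-(t : ℝ)) * (C * (1 + t))
        ≤ Real.exp (-(t : ℝ)) * (C * (2 * Real.exp (t / 2))) := by gcongr; linarith
      _ = 2 * C * (Real.exp (-(t : ℝ)) * Real.exp (t / 2)) := by ring
      _ = _ := by rw [h2]
  have hslice (t : ℝ≥0) : ∫⁻ ω, ‖Real.exp (-(t : ℝ)) * Y t ω‖ₑ ∂P ≤
      ENNReal.ofReal (2 * C * Real.exp (-1 / 2 * t)) := by
    simp_rw [enorm_mul]
    rw [lintegral_const_mul _ (hY.measurable t).enorm, Real.enorm_eq_ofReal (Real.exp_pos _).le]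
    refine le_trans (mul_le_mul_right (hYC t) _) ?_
    rw [← ENNReal.ofReal_mul (Real.exp_pos _).le]
    exact ENNReal.ofReal_le_ofReal (hexp t)
  have htail (T : ℝ≥0) : ∫⁻ ω, (∫⁻ s in Set.Ioi (T : ℝ), ‖f (ω, s)‖ₑ) ∂P ≤
      ENNReal.ofReal (4 * C * Real.exp (-1 / 2 * T)) := by
    rw [lintegral_lintegral_swap hfm.enorm.aemeasurable]
    have hi := integrableOn_exp_mul_Ioi (a := -1 / 2) (by norm_num) (T : ℝ)
    calc ∫⁻ s in Set.Ioi (T : ℝ), ∫⁻ ω, ‖f (ω, s)‖ₑ ∂P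
        ≤ ∫⁻ s in Set.Ioi (T : ℝ), ENNReal.ofReal (2 * C * Real.exp (-1 / 2 * s)) := by
          refine setLIntegral_mono (by fun_prop) fun s hs ↦ ?_
          have hs0 : 0 ≤ s := T.2.trans (le_of_lt hs)
          have := hslice s.toNNReal
          rw [Real.coe_toNNReal s hs0] at this
          exact this
      _ = ENNReal.ofReal (∫ s in Set.Ioi (T : ℝ), 2 * C * Real.exp (-1 / 2 * s)) := by
          rw [ofReal_integral_eq_lintegral_ofReal (hi.const_mul _)
            (ae_of_all _ fun s ↦ by positivity)]
      _ = _ := by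
          rw [integral_const_mul, integral_exp_mul_Ioi (by norm_num)]
          congr 1
          ring
  -- After integration by parts the boundary term `e^{-T} Y(T)` tends to `0` in `L¹`, so this
  -- integral is the limit.
  set X : Ω → ℝ := fun ω ↦ ∫ s in Set.Ioi (0 : ℝ), f (ω, s) with hX
  have hXm : Measurable X :=
    (hfm.stronglyMeasurable.integral_prod_right (ν := volume.restrict (Set.Ioi (0 : ℝ)))).measurable
  have hYae := hY.aemeasurable_expIntegral
  have hint : ∀ᵐ ω ∂P, IntegrableOn (fun s ↦ f (ω, s)) (Set.Ioi 0) := by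
    have h1 := (htail 0).trans_lt ENNReal.ofReal_lt_top
    have h2 := ae_lt_top (Measurable.lintegral_prod_right hfm.enorm) h1.ne
    filter_upwards [h2] with ω hω
    exact ⟨(hfm.comp measurable_prodMk_left).aestronglyMeasurable, hω⟩
  have hdiff (T : ℝ≥0) : ∀ᵐ ω ∂P, expIntegral Y T ω - X ω =
      Real.exp (-(T : ℝ)) * Y T ω - ∫ s in Set.Ioi (T : ℝ), f (ω, s) := by
    filter_upwards [hint, hY.start_zero] with ω hω h0
    have h1 := intervalIntegral.integral_Ioi_sub_Ioi hω T.2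
    have h2 : ∫ s in (0 : ℝ)..T, Real.exp (-s) * Y s.toNNReal ω =
      X ω - ∫ s in Set.Ioi (T : ℝ), f (ω, s) := h1.symm
    rw [expIntegral, h0, h2]
    ring
  refine ⟨X, hXm, tendstoInMeasure_of_tendsto_eLpNorm one_ne_zero
    (fun T ↦ (hYae T).aestronglyMeasurable) hXm.aestronglyMeasurable ?_⟩
  have hub (T : ℝ≥0) : eLpNorm (expIntegral Y T - X) 1 P ≤
      ENNReal.ofReal (6 * C * Real.exp (-1 / 2 * T)) := by
    rw [eLpNorm_one_eq_lintegral_enorm]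
    calc ∫⁻ ω, ‖(expIntegral Y T - X) ω‖ₑ ∂P
        ≤ ∫⁻ ω, (‖Real.exp (-(T : ℝ)) * Y T ω‖ₑ + ∫⁻ s in Set.Ioi (T : ℝ), ‖f (ω, s)‖ₑ) ∂P := by
          refine lintegral_mono_ae ?_
          filter_upwards [hdiff T] with ω hω
          rw [Pi.sub_apply, hω]
          exact enorm_sub_le.trans (by gcongr; exact enorm_integral_le_lintegral_enorm _)
      _ = ∫⁻ ω, ‖Real.exp (-(T : ℝ)) * Y T ω‖ₑ ∂P +
            ∫⁻ ω, (∫⁻ s in Set.Ioi (T : ℝ), ‖f (ω, s)‖ₑ) ∂P :=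
          lintegral_add_left ((hY.measurable T).const_mul _).enorm _
      _ ≤ _ := by
          refine (add_le_add (hslice T) (htail T)).trans ?_
          rw [← ENNReal.ofReal_add (by positivity) (by positivity)]
          refine ENNReal.ofReal_le_ofReal (le_of_eq ?_)
          ring
  have hlim : Tendsto (fun T : ℝ≥0 ↦ ENNReal.ofReal (6 * C * Real.exp (-1 / 2 * T))) atTop
      (𝓝 0) := by
    have h1 : Tendsto (fun T : ℝ≥0 ↦ -1 / 2 * (T : ℝ)) atTop atBot :=
      (NNReal.tendsto_coe_atTop.2 tendsto_id).const_mul_atTop_of_neg (by norm_num)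
    have h2 := (Real.tendsto_exp_atBot.comp h1).const_mul (6 * C)
    rw [mul_zero] at h2
    have h3 := (ENNReal.continuous_ofReal.tendsto 0).comp h2
    rw [ENNReal.ofReal_zero] at h3
    exact h3
  exact tendsto_of_tendsto_of_tendsto_of_le_of_le tendsto_const_nhds hlim (fun _ ↦ zero_le) hub

end ExpIntegral

/-! ### Uniqueness and construction of the driving process -/

section Driving

variable {Ω : Type*} [MeasurableSpace Ω] {P : Measure Ω}

lemma IsLevyProcess.tendsto_exp_integral_exponent_charFun [IsProbabilityMeasure P]
    {Y : ℝ≥0 → Ω → ℝ} (hY : IsLevyProcess Y P) {η : ℝ → ℂ} (hη : Continuous η)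
    (hYη : ∀ (t : ℝ≥0) θ, charFun (P.map (Y t)) θ = Complex.exp (t * η θ))
    {X : Ω → ℝ} (hX : Measurable X) (hYX : TendstoInMeasure P (expIntegral Y) atTop X) (θ : ℝ) :
    Tendsto (fun T : ℝ≥0 ↦ Complex.exp (∫ s in (0 : ℝ)..T, η (θ * Real.exp (-s)))) atTop
      (𝓝 (charFun (P.map X) θ)) := by
  refine (tendsto_charFun_of_tendstoInMeasure hY.aemeasurable_expIntegral hX.aemeasurable hYX
    θ).congr' ?_
  filter_upwards [eventually_gt_atTop 0] with T hT
  exact hY.charFun_expIntegral hη hYη hT θ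

end Driving

lemma IsBDCF.eq_logGammaBDCF {α lam : ℝ} (hα : 0 < α) (hlam : 0 < lam) {χ : ℝ → ℂ}
    (h : IsBDCF.{u} (charFun (logGammaLaw α lam)) χ) : χ = logGammaBDCF α lam := by
  obtain ⟨Ω, _, P, Y, X, _, hY, -, hX, hYX, hφ, rfl⟩ := h
  obtain ⟨η, hη, hYη⟩ := hY.exists_exponent
  obtain ⟨φ', hder, hφ', hne⟩ := hasDerivAt_charFun_logGammaLaw hα hlam
  have hlim := hY.tendsto_exp_integral_exponent_charFun hη hYη hX hYX
  rw [hφ] at hlim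
  ext θ
  have h1 := (exponent_mul_eq_of_tendsto hη hder hlim θ).trans (hφ' θ)
  rw [hYη, mul_right_cancel₀ (hne θ) h1, logGammaBDCF_eq hα]
  simp

/-- The Lévy process driving the law of `log γ_{α,λ}`, where `c` is the mean of that law. -/
noncomputable def drivingPath (α c : ℝ) (t : ℝ≥0) (ω : MarkSpace) : ℝ :=
  c * t + limitJumps α t ω

lemma measurable_drivingPath_uncurry (α c : ℝ) :
    Measurable fun z : ℝ≥0 × MarkSpace ↦ drivingPath α c z.1 z.2 := by
  have h := measurable_limitJumps_uncurry α
  exact Measurable.add (by fun_prop) h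

lemma measurable_drivingPath (α c : ℝ) (t : ℝ≥0) : Measurable (drivingPath α c t) := by
  exact measurable_const.add (measurable_limitJumps α t)

lemma hasIncrementExponent_drivingPath {α : ℝ} (hα : 0 < α) (c : ℝ) :
    HasIncrementExponent (drivingPath α c) markMeasure (fun s t θ ↦ ((t - s : ℝ) : ℂ) *
      (Complex.I * θ * c + ∑' k : ℕ, levyTerm (α + k) θ)) := by
  have h := (hasIncrementExponent_limitJumps hα).add_linear (measurable_limitJumps α) c
  intro s hs m θ
  refine (h s hs m θ).trans ?_
  congr 1
  refine Finset.sum_congr rfl fun j _ ↦ ?_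
  ring

lemma drivingPath_zero (α c : ℝ) (ω : MarkSpace) : drivingPath α c 0 ω = 0 := by
  simp [drivingPath, limitJumps_zero]

lemma charFun_drivingPath {α : ℝ} (hα : 0 < α) (c : ℝ) (t : ℝ≥0) (θ : ℝ) :
    charFun (markMeasure.map (drivingPath α c t)) θ =
      Complex.exp (t * (Complex.I * θ * c + ∑' k : ℕ, levyTerm (α + k) θ)) := by
  have h := (hasIncrementExponent_drivingPath hα c).charFun_sub (zero_le (a := t))
    (measurable_drivingPath α c) θ
  simpa [drivingPath_zero] using h

lemma isLevyProcess_drivingPath {α : ℝ} (hα : 0 < α) (c : ℝ) :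
    IsLevyProcess (drivingPath α c) markMeasure where
  measurable := measurable_drivingPath α c
  start_zero := ae_of_all _ (drivingPath_zero α c)
  indep_increments := (hasIncrementExponent_drivingPath hα c).hasIndepIncrements
    (measurable_drivingPath α c)
  stationary_increments s t := by
    have hm := measurable_drivingPath α c
    have := Measure.isProbabilityMeasure_map (μ := markMeasure) (hm t).aemeasurable
    have := Measure.isProbabilityMeasure_map (μ := markMeasure)
      ((hm (s + t)).sub (hm s)).aemeasurable
    refine Measure.ext_of_charFun ?_
    ext θ
    rw [charFun_drivingPath hα]
    refine ((hasIncrementExponent_drivingPath hα c).charFun_sub (le_self_add (a := s) (b := t))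
      hm θ).trans ?_
    simp
  cadlag := by
    filter_upwards [ae_isCadlag_limitJumps hα] with ω hω
    exact (Continuous.isCadlag (f := fun t : ℝ≥0 ↦ c * (t : ℝ)) (by fun_prop)).add hω.1

lemma lintegral_enorm_drivingPath_le {α : ℝ} (hα : 0 < α) (c : ℝ) (t : ℝ≥0) :
    ∫⁻ ω, ‖drivingPath α c t ω‖ₑ ∂markMeasure ≤
      ENNReal.ofReal ((1 + |c| + 4 * ∑' k : ℕ, 1 / (α + k) ^ 2) * (1 + t)) := by
  have hS : 0 ≤ ∑' k : ℕ, 1 / (α + k) ^ 2 := tsum_nonneg fun k ↦ by positivity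
  calc ∫⁻ ω, ‖drivingPath α c t ω‖ₑ ∂markMeasure
      ≤ ∫⁻ ω, (‖c * (t : ℝ)‖ₑ + ‖limitJumps α t ω‖ₑ) ∂markMeasure :=
        lintegral_mono fun ω ↦ enorm_add_le _ _
    _ = ‖c * (t : ℝ)‖ₑ + ∫⁻ ω, ‖limitJumps α t ω‖ₑ ∂markMeasure := by
        rw [lintegral_add_left measurable_const, lintegral_const, measure_univ, mul_one]
    _ ≤ ENNReal.ofReal (|c| * t) +
          ENNReal.ofReal (1 + 4 * (∑' k : ℕ, 1 / (α + k) ^ 2) * t) := by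
        refine add_le_add (le_of_eq ?_) (lintegral_enorm_limitJumps_le hα t)
        rw [Real.enorm_eq_ofReal_abs, abs_mul, NNReal.abs_eq]
    _ ≤ _ := by
        rw [← ENNReal.ofReal_add (by positivity) (by positivity)]
        refine ENNReal.ofReal_le_ofReal ?_
        nlinarith [NNReal.coe_nonneg t, abs_nonneg c]

lemma integrable_log_one_add_abs {Ω : Type*} [MeasurableSpace Ω] {P : Measure Ω} {f : Ω → ℝ}
    (hf : Integrable f P) : Integrable (fun ω ↦ Real.log (1 + |f ω|)) P := by
  refine hf.mono (Real.measurable_log.comp_aemeasurable (by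
    have := hf.aemeasurable; fun_prop)).aestronglyMeasurable (ae_of_all _ fun ω ↦ ?_)
  rw [Real.norm_of_nonneg (Real.log_nonneg (by linarith [abs_nonneg (f ω)])), Real.norm_eq_abs]
  linarith [Real.log_le_sub_one_of_pos (x := 1 + |f ω|) (by positivity)]

lemma isBDCF_logGammaBDCF {α lam : ℝ} (hα : 0 < α) (hlam : 0 < lam) :
    IsBDCF.{0} (charFun (logGammaLaw α lam)) (logGammaBDCF α lam) := by
  obtain ⟨d, hd, -⟩ := exists_digamma_eq_and_Gamma_div_Gamma_eq hα
  set c : ℝ := -Real.log lam + d with hc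
  have hexp (θ : ℝ) : Complex.I * θ * c + ∑' k : ℕ, levyTerm (α + k) θ =
      logGammaExponent α lam θ := by
    rw [logGammaExponent, hc, ← hd]
    push_cast
    rfl
  have hY := isLevyProcess_drivingPath hα c
  have hYη (t : ℝ≥0) (θ : ℝ) : charFun (markMeasure.map (drivingPath α c t)) θ =
      Complex.exp (t * logGammaExponent α lam θ) := by
    rw [charFun_drivingPath hα, hexp]
  -- Continuity comes from the Lévy process itself: its continuous exponent must coincide with this
  -- one.
  have hη : Continuous (logGammaExponent α lam) := by
    obtain ⟨η, hη, h⟩ := hY.exists_exponent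
    have : logGammaExponent α lam = η := funext fun θ ↦
      eq_of_forall_exp_mul_eq fun t ↦ (hYη t θ).symm.trans (h t θ)
    rwa [this]
  have hS : 0 ≤ ∑' k : ℕ, 1 / (α + k) ^ 2 := tsum_nonneg fun k ↦ by positivity
  have hbound := lintegral_enorm_drivingPath_le hα c
  obtain ⟨X, hX, hYX⟩ := hY.exists_tendstoInMeasure_expIntegral
    (measurable_drivingPath_uncurry α c) (by positivity) hbound
  obtain ⟨φ', hder, hφ', hne⟩ := hasDerivAt_charFun_logGammaLaw hα hlam
  have : IsProbabilityMeasure (gammaMeasure α lam) := isProbabilityMeasure_gammaMeasure hα hlam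
  have : IsProbabilityMeasure (logGammaLaw α lam) :=
    Measure.isProbabilityMeasure_map Real.measurable_log.aemeasurable
  refine ⟨MarkSpace, inferInstance, markMeasure, drivingPath α c, X, inferInstance, hY,
    integrable_log_one_add_abs ⟨(hY.measurable 1).aestronglyMeasurable,
      (hbound 1).trans_lt ENNReal.ofReal_lt_top⟩, hX, hYX, ?_, ?_⟩
  · ext θ
    exact tendsto_nhds_unique (hY.tendsto_exp_integral_exponent_charFun hη hYη hX hYX θ)
      (tendsto_exp_integral_exponent hη hder (by simp) hne hφ' θ)
  · ext θ
    rw [hYη, logGammaBDCF_eq hα]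
    simp

theorem proposition3 (α lam : ℝ) (hα : 0 < α) (hlam : 0 < lam) :
    IsBDCF.{0} (charFun (logGammaLaw α lam)) (logGammaBDCF α lam) ∧
    (∀ χ : ℝ → ℂ, IsBDCF.{u} (charFun (logGammaLaw α lam)) χ → χ = logGammaBDCF α lam) ∧
    (∀ t : ℝ, IntegrableOn (bdcfIntegrand α t) (Set.Ioi 0)) ∧
    IntegrableOn (fun x : ℝ ↦ x ^ 2 * (Real.exp (-(α * x)) * hFun α x)) (Set.Ioi 0) :=
  ⟨isBDCF_logGammaBDCF hα hlam, fun _ h ↦ h.eq_logGammaBDCF hα hlam,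
    integrableOn_bdcfIntegrand hα, integrableOn_sq_mul_hFun hα⟩
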